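/- **Setting.** Let $\mathbb T\subset\mathbb C$ be the unit circle, with normalized arc length measure, $L^2=L^2(\mathbb T)$, $H^2\subset L^2$ the Hardy space and $\mathbb P:L^2\to H^2$ the orthogonal (Riesz) projection. $\mathrm{Rat}(\mathbb T)$ is the set of complex rational functions whose poles in $\mathbb C$ all lie on $\mathbb T$, and $\mathrm{Rat}_0(\mathbb T)$ is the set of strictly proper functions in it. For $\omega\in\mathrm{Rat}(\mathbb T)$, the operator $T_\omega\,(H^2\to H^2)$ is defined by $$\mathrm{Dom}(T_\omega)=\{g\in H^2 : \omega g=f+\rho \text{ with } f\in L^2,\ \rho\in\mathrm{Rat}_0(\mathbb T)\},\qquad T_\omega g=\mathbb P f,$$ and $T_\omega^*$ is its Hilbert space adjoint. An operator $A$ is symmetric if it is densely defined and $\langle Ax,y\rangle=\langle x,Ay\rangle$ for all $x,y\in\mathrm{Dom}(A)$. Put $\omega(\mathbb T)=\{\omega(z): z\in\mathbb T,\ z\text{ not a pole of }\omega\}$. The essential spectrum $\sigma_{\mathrm{ess}}(T_\omega)$ is the set of $\lambda\in\mathbb C$ for which $T_\omega-\lambda I$ is not Fredholm; here a Fredholm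 operator is a closed operator with finite dimensional kernel and closed range of finite codimension. For a polynomial $r$ of degree $k$ let $r^\sharp(z)=z^k\,\overline{r(1/\overline z)}$; a polynomial $r\neq0$ is self-inversive if $r=\gamma r^\sharp$ for some constant $\gamma\in\mathbb C$. **Theorem.** Let $\omega=s/q\in\mathrm{Rat}(\mathbb T)$ with $s,q$ co-prime complex polynomials, $q\ne0$. Write $s(z)=\sum_{k=0}^n s_kz^k$ and $q(z)=\sum_{k=0}^m q_kz^k$ with $n=\deg s$, $m=\deg q$. The following are equivalent. 1. $T_\omega^*$ is symmetric. 2. $\omega(\mathbb T)\subset\mathbb R$. 3. $\omega(z)=\widetilde\omega\left(-i\,\frac{z+1}{z-1}\right)$ for a rational function $\widetilde\omega$ with real coefficients whose poles in $\mathbb C$ all lie on $\mathbb R$. 4. $\sigma_{\mathrm{ess}}(T_\omega)\subset\mathbb R$. 5. Either $s=0$, or $\omega$ is proper (that is, $n\le m$), $s=z^{m-n}\widetilde s$ with $\widetilde s$ a self-inversive polynomial, and $q_0\overline{s_n}=\overline{q_m}\,s_{m-n}$. Moreover, if $T_\omega^*$ is symmetric, then $T_\omega^*\subset T_\omega$,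 that is, $T_\omega$ extends $T_\omega^*$. -/

import Mathlib

open MeasureTheory Polynomial ComplexConjugate

noncomputable section

namespace ToeplitzLike

/-! ### The Hardy space `H²` of the unit circle -/

/-- `L²` of the unit circle with respect to normalized arc length. The circle is parametrized by
`UnitAddCircle = ℝ / ℤ` through `t ↦ exp (2 π i t)`, see `pt`. -/
abbrev L2 : Type := Lp ℂ 2 (@AddCircle.haarAddCircle (1 : ℝ) _)

/-- The point `z = exp (2 π i t)` of the unit circle. -/
def pt (t : UnitAddCircle) : ℂ := (AddCircle.toCircle t : ℂ)

/-- The Hardy space `H²`: the functions in `L²` of the circle whose Fourier coefficients of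
negative index vanish. -/
def H2 : Submodule ℂ L2 where
  carrier := {f | ∀ n : ℤ, n < 0 → fourierCoeff (f : UnitAddCircle → ℂ) n = 0}
  zero_mem' := by
    intro n _
    rw [← fourierBasis_repr]
    simp
  add_mem' := by
    intro f g hf hg n hn
    have h1 := hf n hn
    have h2 := hg n hn
    rw [← fourierBasis_repr] at h1 h2 ⊢
    simp [h1, h2]
  smul_mem' := by
    intro c f hf n hn
    have h1 := hf n hn
    rw [← fourierBasis_repr] at h1 ⊢
    simp [h1]

theorem isClosed_H2 : IsClosed (H2 : Set L2) := by
  have : (H2 : Set L2) = ⋂ n : ℤ, ⋂ _ : n < 0, {f : L2 | fourierBasis.repr f n = 0} := by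
    ext f
    simp only [Set.mem_iInter, Set.mem_ofPred_eq, SetLike.mem_coe, fourierBasis_repr]
    rfl
  rw [this]
  refine isClosed_iInter fun n => isClosed_iInter fun _ => ?_
  refine isClosed_eq ?_ continuous_const
  have h : Continuous fun f : L2 => inner ℂ (fourierBasis n : L2) f := by fun_prop
  convert h using 2 with f
  rw [HilbertBasis.repr_apply_apply]

instance : CompleteSpace H2 := isClosed_H2.completeSpace_coe

/-- The Riesz projection `ℙ` of `L²` onto `H²`, that is, the orthogonal projection. -/
def rieszProj : L2 →L[ℂ] H2 := H2.orthogonalProjectionOnto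

/-! ### Rational functions -/

/-- The value of a rational function at a complex number that is not a pole. -/
def val (ω : RatFunc ℂ) (z : ℂ) : ℂ := ω.eval (RingHom.id ℂ) z

/-- `z` is a pole of the rational function `ω` (`RatFunc.denom` is the denominator of `ω` in
lowest terms). -/
def IsPole (ω : RatFunc ℂ) (z : ℂ) : Prop := ω.denom.eval z = 0

/-- `Rat(𝕋)`: the rational functions all of whose poles in `ℂ` lie on the unit circle. -/
def RatT : Set (RatFunc ℂ) := {ω | ∀ z, IsPole ω z → ‖z‖ = 1}

/-- A rational function is strictly proper if its numerator has smaller degree than its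
denominator. -/
def StrictlyProper (ω : RatFunc ℂ) : Prop := ω.num.degree < ω.denom.degree

/-- `Rat₀(𝕋)`: the strictly proper rational functions in `Rat(𝕋)`. -/
def Rat0T : Set (RatFunc ℂ) := {ω | ω ∈ RatT ∧ StrictlyProper ω}

/-- `ω(𝕋)`: the set of values of `ω` on the unit circle, poles excluded. -/
def circleImage (ω : RatFunc ℂ) : Set ℂ := {w | ∃ z : ℂ, ‖z‖ = 1 ∧ ¬ IsPole ω z ∧ val ω z = w}

theorem val_add {ρ τ : RatFunc ℂ} {z : ℂ} (h1 : ¬ IsPole ρ z) (h2 : ¬ IsPole τ z) :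
    val (ρ + τ) z = val ρ z + val τ z := by
  apply RatFunc.eval_add
  · simpa [IsPole, Polynomial.eval₂_id] using h1
  · simpa [IsPole, Polynomial.eval₂_id] using h2

theorem strictlyProper_iff {ρ : RatFunc ℂ} {a b : ℂ[X]} (hb : b ≠ 0)
    (h : a * ρ.denom = ρ.num * b) : StrictlyProper ρ ↔ a.degree < b.degree := by
  have h1 := congrArg Polynomial.degree h
  rw [degree_mul, degree_mul] at h1
  have hd : ρ.denom.degree = (ρ.denom.natDegree : WithBot ℕ) := degree_eq_natDegree ρ.denom_ne_zero
  have hb' : b.degree = (b.natDegree : WithBot ℕ) := degree_eq_natDegree hb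
  unfold StrictlyProper
  rw [hd, hb'] at h1 ⊢
  by_cases hn : ρ.num = 0
  · have ha : a = 0 := by
      have := h
      rw [hn, zero_mul] at this
      exact (mul_eq_zero.mp this).resolve_right ρ.denom_ne_zero
    simp [hn, ha]
  · have ha : a ≠ 0 := by
      rintro rfl
      rw [zero_mul] at h
      exact (mul_ne_zero hn hb) h.symm
    rw [degree_eq_natDegree hn, degree_eq_natDegree ha] at h1 ⊢
    have h2 : ((a.natDegree + ρ.denom.natDegree : ℕ) : WithBot ℕ) =
        ((ρ.num.natDegree + b.natDegree : ℕ) : WithBot ℕ) := by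
      push_cast
      exact h1
    rw [Nat.cast_inj] at h2
    rw [Nat.cast_lt, Nat.cast_lt]
    omega

theorem zero_mem_Rat0T : (0 : RatFunc ℂ) ∈ Rat0T := by
  constructor
  · intro z hz
    simp [IsPole] at hz
  · simp [StrictlyProper]

theorem add_mem_Rat0T {ρ τ : RatFunc ℂ} (hρ : ρ ∈ Rat0T) (hτ : τ ∈ Rat0T) : ρ + τ ∈ Rat0T := by
  constructor
  · intro z hz
    have h := Polynomial.eval₂_eq_zero_of_dvd_of_eval₂_eq_zero (RingHom.id ℂ) z
      (RatFunc.denom_add_dvd ρ τ) (by simpa [IsPole, Polynomial.eval₂_id] using hz)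
    rw [Polynomial.eval₂_id, Polynomial.eval_mul, mul_eq_zero] at h
    exact h.elim (hρ.1 z) (hτ.1 z)
  · have hb : ρ.denom * τ.denom ≠ 0 := mul_ne_zero ρ.denom_ne_zero τ.denom_ne_zero
    rw [strictlyProper_iff hb (RatFunc.num_denom_add ρ τ).symm]
    have h1 : ρ.num.degree < ρ.denom.degree := hρ.2
    have h2 : τ.num.degree < τ.denom.degree := hτ.2
    refine lt_of_le_of_lt (degree_add_le _ _) (max_lt ?_ ?_)
    · rw [degree_mul, degree_mul]
      exact WithBot.add_lt_add_right (by simpa using τ.denom_ne_zero) h1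
    · rw [degree_mul, degree_mul]
      exact WithBot.add_lt_add_left (by simpa using ρ.denom_ne_zero) h2

theorem C_mul_mem_Rat0T (c : ℂ) {ρ : RatFunc ℂ} (hρ : ρ ∈ Rat0T) : RatFunc.C c * ρ ∈ Rat0T := by
  have key : (RatFunc.C c * ρ).num * ρ.denom = (C c * ρ.num) * (RatFunc.C c * ρ).denom := by
    have := RatFunc.num_denom_mul (RatFunc.C c) ρ
    simpa using this
  constructor
  · intro z hz
    have h := Polynomial.eval₂_eq_zero_of_dvd_of_eval₂_eq_zero (RingHom.id ℂ) z
      (RatFunc.denom_mul_dvd (RatFunc.C c) ρ) (by simpa [IsPole, Polynomial.eval₂_id] using hz)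
    apply hρ.1 z
    simpa [IsPole, Polynomial.eval₂_id] using h
  · rw [strictlyProper_iff ρ.denom_ne_zero key.symm]
    have h1 : ρ.num.degree < ρ.denom.degree := hρ.2
    refine lt_of_le_of_lt ?_ h1
    by_cases hc : c = 0
    · simp [hc]
    · rw [degree_mul, degree_C hc, zero_add]

theorem val_C_mul (c : ℂ) {ρ : RatFunc ℂ} {z : ℂ} (h : ¬ IsPole ρ z) :
    val (RatFunc.C c * ρ) z = c * val ρ z := by
  unfold val
  rw [RatFunc.eval_mul]
  · simp
  · simp
  · simpa [IsPole, Polynomial.eval₂_id] using h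

theorem ae_not_isPole (ρ : RatFunc ℂ) :
    ∀ᵐ t ∂(@AddCircle.haarAddCircle (1 : ℝ) _), ¬ IsPole ρ (pt t) := by
  have hfin : {t : UnitAddCircle | IsPole ρ (pt t)}.Finite := by
    have h : {z : ℂ | IsPole ρ z}.Finite := by
      refine (ρ.denom.roots.toFinset.finite_toSet).subset fun z hz => ?_
      simpa [ρ.denom_ne_zero, IsPole] using hz
    refine Set.Finite.preimage (f := pt) (fun a _ b _ hab => ?_) h
    exact AddCircle.injective_toCircle one_ne_zero (Subtype.ext hab)
  have : AddCircle.haarAddCircle {t : UnitAddCircle | IsPole ρ (pt t)} = 0 := by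
    have : NullSingletonClass (volume : Measure UnitAddCircle) := ⟨fun x => by
      rw [← Metric.closedBall_zero, AddCircle.volume_closedBall]
      simp⟩
    have h0 : volume {t : UnitAddCircle | IsPole ρ (pt t)} = 0 := hfin.measure_zero _
    rw [AddCircle.volume_eq_smul_haarAddCircle] at h0
    simpa using h0
  rw [ae_iff]
  simpa using this

/-! ### The Toeplitz-like operator -/

/-- A square integrable function does not solve `(z - α) u = 1` on the circle if `|α| = 1`. -/
theorem no_L2_inverse {α : ℂ} (hα : ‖α‖ = 1) (u : L2)
    (h : ∀ᵐ t ∂(@AddCircle.haarAddCircle (1 : ℝ) _), (pt t - α) * u t = 1) : False := by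
  set c : ℤ → ℂ := fun n => fourierCoeff (u : UnitAddCircle → ℂ) n with hc
  have hu : Integrable (u : UnitAddCircle → ℂ) AddCircle.haarAddCircle :=
    (Lp.memLp u).integrable (by norm_num)
  have hi : ∀ n : ℤ, Integrable (fun t => fourier n t * (u : UnitAddCircle → ℂ) t)
      AddCircle.haarAddCircle := fun n => hu.fourier_smul n
  have hrec : ∀ n : ℤ, c (n - 1) - α * c n = if n = 0 then 1 else 0 := by
    intro n
    have h1 : fourierCoeff (fourier 0 : UnitAddCircle → ℂ) n = if n = 0 then 1 else 0 := by
      rw [fourierCoeff_fourier]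
      simp [Pi.single_apply]
    rw [← h1]
    simp only [hc, fourierCoeff]
    rw [← integral_const_mul, ← integral_sub]
    · apply integral_congr_ae
      filter_upwards [h] with t ht
      have h2 : (fourier (-(n - 1)) t : ℂ) = fourier (-n) t * pt t := by
        rw [show -(n - 1) = -n + 1 by ring, fourier_add, fourier_one]
        rfl
      simp only [smul_eq_mul, h2, fourier_zero]
      rw [← ht]
      ring
    · exact hi _
    · exact (hi _).const_mul _
  have hsum : Summable fun n : ℤ => ‖c n‖ ^ 2 := (hasSum_sq_fourierCoeff u).summable
  have hpos : ∀ n : ℕ, ‖c n‖ = ‖c 0‖ := by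
    intro n
    induction n with
    | zero => rfl
    | succ k ih =>
      have h1 := hrec ((k : ℤ) + 1)
      rw [if_neg (by omega), add_sub_cancel_right, sub_eq_zero] at h1
      rw [← ih, h1, norm_mul, hα, one_mul]
      push_cast
      rfl
  have hneg : ∀ n : ℕ, ‖c (-1 - n)‖ = ‖c (-1)‖ := by
    intro n
    induction n with
    | zero => simp
    | succ k ih =>
      have h1 := hrec (-1 - k)
      rw [if_neg (by omega), sub_eq_zero] at h1
      rw [← ih, ← one_mul ‖c (-1 - k)‖, ← hα, ← norm_mul, ← h1]
      congr 2
      push_cast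
      ring
  have h0 : ‖c 0‖ = 0 := by
    have h1 := (hsum.comp_injective Nat.cast_injective).tendsto_atTop_zero
    simp only [Function.comp_def, hpos] at h1
    simpa using tendsto_nhds_unique tendsto_const_nhds h1
  have h1 : ‖c (-1)‖ = 0 := by
    have hinj : Function.Injective (fun n : ℕ => (-1 - n : ℤ)) := fun a b hab => by
      simpa using hab
    have h1 := (hsum.comp_injective hinj).tendsto_atTop_zero
    simp only [Function.comp_def, hneg] at h1
    simpa using tendsto_nhds_unique tendsto_const_nhds h1
  have h2 := hrec 0
  rw [norm_eq_zero] at h0 h1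
  simp [h0, h1] at h2

theorem continuous_pt : Continuous pt := continuous_subtype_val.comp AddCircle.continuous_toCircle

theorem memLp_continuous_mul {w : UnitAddCircle → ℂ} (hw : Continuous w) (f : L2) :
    MemLp (fun t => w t * f t) 2 (@AddCircle.haarAddCircle (1 : ℝ) _) := by
  have h : MemLp w ⊤ (@AddCircle.haarAddCircle (1 : ℝ) _) := by
    obtain ⟨C, hC⟩ := isCompact_univ.exists_bound_of_continuousOn hw.continuousOn
    exact memLp_top_of_bound hw.aestronglyMeasurable C (.of_forall fun t => hC t trivial)
  exact (Lp.memLp f).mul' h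

/-- A function in `Rat₀(𝕋)` that is square integrable on the circle is zero. -/
theorem eq_zero_of_ae_eq {ρ : RatFunc ℂ} (hρ : ρ ∈ Rat0T) (f : L2)
    (h : ∀ᵐ t ∂(@AddCircle.haarAddCircle (1 : ℝ) _), val ρ (pt t) = f t) : ρ = 0 := by
  by_contra h0
  have hnum : ρ.num ≠ 0 := by simpa using h0
  have hdeg : 0 < ρ.denom.degree := lt_of_le_of_lt (zero_le_degree_iff.mpr hnum) hρ.2
  obtain ⟨α, hα⟩ := Complex.exists_root hdeg
  obtain ⟨d, hd⟩ := dvd_iff_isRoot.mpr hα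
  have hα1 : ‖α‖ = 1 := hρ.1 α hα
  have hb : ρ.num.eval α ≠ 0 := by
    intro hb
    obtain ⟨a, b, hab⟩ := ρ.isCoprime_num_denom
    have h1 := congrArg (Polynomial.eval α) hab
    rw [eval_add, eval_mul, eval_mul, hb, hα.eq_zero] at h1
    simp at h1
  obtain ⟨w, hw⟩ : X - C α ∣ ρ.num - C (ρ.num.eval α) := by
    rw [dvd_iff_isRoot]
    simp
  set b := ρ.num.eval α with hbdef
  -- the function `(d f - w) / b` inverts `z - α`
  have hc1 : Continuous fun t => b⁻¹ * d.eval (pt t) :=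
    continuous_const.mul (d.continuous.comp continuous_pt)
  have hc2 : Continuous fun t => b⁻¹ * w.eval (pt t) :=
    continuous_const.mul (w.continuous.comp continuous_pt)
  have hm2 : MemLp (fun t => b⁻¹ * w.eval (pt t)) 2 (@AddCircle.haarAddCircle (1 : ℝ) _) := by
    obtain ⟨C, hC⟩ := isCompact_univ.exists_bound_of_continuousOn hc2.continuousOn
    exact MemLp.of_bound hc2.aestronglyMeasurable C (.of_forall fun t => hC t trivial)
  have hm := (memLp_continuous_mul hc1 f).sub hm2
  refine no_L2_inverse hα1 (hm.toLp _) ?_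
  filter_upwards [hm.coeFn_toLp, h, ae_not_isPole ρ] with t h1 h2 h3
  rw [h1, Pi.sub_apply, ← h2]
  have h4 : val ρ (pt t) * ((pt t - α) * d.eval (pt t)) = ρ.num.eval (pt t) := by
    have h5 : ρ.denom.eval (pt t) = (pt t - α) * d.eval (pt t) := by
      rw [hd]
      simp
    rw [← h5]
    unfold val RatFunc.eval
    rw [eval₂_id, eval₂_id]
    exact div_mul_cancel₀ _ h3
  have h6 : ρ.num.eval (pt t) - b = (pt t - α) * w.eval (pt t) := by
    have := congrArg (Polynomial.eval (pt t)) hw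
    simpa using this
  calc _ = b⁻¹ * (val ρ (pt t) * ((pt t - α) * d.eval (pt t)) - (pt t - α) * w.eval (pt t)) := by
        ring
    _ = 1 := by
        rw [h4, ← h6, sub_sub_cancel, inv_mul_cancel₀ hb]

/-- The graph of `T_ω`: the pairs `(g, ℙ f)` with `g ∈ H²`, `f ∈ L²` and `ω g = f + ρ` almost
everywhere on the circle for some `ρ ∈ Rat₀(𝕋)`. -/
def toeplitzGraph (ω : RatFunc ℂ) : Submodule ℂ (H2 × H2) where
  carrier := {x | ∃ f : L2, ∃ ρ ∈ Rat0T,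
    (∀ᵐ t ∂(@AddCircle.haarAddCircle (1 : ℝ) _),
      val ω (pt t) * (x.1 : L2) t = f t + val ρ (pt t)) ∧ x.2 = rieszProj f}
  zero_mem' := by
    refine ⟨0, 0, zero_mem_Rat0T, ?_, by simp⟩
    filter_upwards [Lp.coeFn_zero ℂ 2 (@AddCircle.haarAddCircle (1 : ℝ) _)] with t ht
    have ht' : (((0 : H2 × H2).1 : H2) : L2) t = 0 := ht
    rw [ht', ht]
    simp [val]
  add_mem' := by
    rintro x y ⟨f, ρ, hρ, hf, hx⟩ ⟨g, τ, hτ, hg, hy⟩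
    refine ⟨f + g, ρ + τ, add_mem_Rat0T hρ hτ, ?_, by simp [hx, hy]⟩
    filter_upwards [hf, hg, Lp.coeFn_add f g, Lp.coeFn_add (x.1 : L2) (y.1 : L2),
      ae_not_isPole ρ, ae_not_isPole τ] with t h1 h2 h3 h4 h5 h6
    have h4' : ((x + y).1 : L2) t = (x.1 : L2) t + (y.1 : L2) t := h4
    rw [h4', h3, val_add h5 h6, mul_add, h1, h2, Pi.add_apply]
    ring
  smul_mem' := by
    rintro c x ⟨f, ρ, hρ, hf, hx⟩
    refine ⟨c • f, RatFunc.C c * ρ, C_mul_mem_Rat0T c hρ, ?_, by simp [hx]⟩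
    filter_upwards [hf, Lp.coeFn_smul c f, Lp.coeFn_smul c (x.1 : L2), ae_not_isPole ρ]
      with t h1 h2 h3 h4
    have h3' : ((c • x).1 : L2) t = c * (x.1 : L2) t := h3
    rw [h3', h2, val_C_mul c h4, Pi.smul_apply, smul_eq_mul, mul_left_comm, h1]
    ring

/-- In `ω g = f + ρ` the function `f`, and hence `ℙ f`, is determined by `g`. -/
theorem toeplitzGraph_functional (ω : RatFunc ℂ) (x : H2 × H2) (hx : x ∈ toeplitzGraph ω)
    (h0 : x.1 = 0) : x.2 = 0 := by
  obtain ⟨f, ρ, hρ, hf, hx2⟩ := hx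
  have hae : ∀ᵐ t ∂(@AddCircle.haarAddCircle (1 : ℝ) _), f t + val ρ (pt t) = 0 := by
    filter_upwards [hf, Lp.coeFn_zero ℂ 2 (@AddCircle.haarAddCircle (1 : ℝ) _)] with t h1 h2
    have h3 : (x.1 : L2) t = 0 := by
      rw [h0]
      exact h2
    rw [← h1, h3, mul_zero]
  have hρ0 : ρ = 0 := by
    refine eq_zero_of_ae_eq hρ (-f) ?_
    filter_upwards [hae, Lp.coeFn_neg f] with t h1 h2
    rw [h2, Pi.neg_apply]
    exact eq_neg_of_add_eq_zero_right h1
  have hf0 : f = 0 := by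
    apply Lp.ext
    filter_upwards [hae, Lp.coeFn_zero ℂ 2 (@AddCircle.haarAddCircle (1 : ℝ) _)] with t h1 h2
    rw [h2]
    simpa [hρ0, val] using h1
  rw [hx2, hf0, map_zero]

/-- The Toeplitz-like operator `T_ω (H² → H²)`: its domain consists of the `g ∈ H²` with
`ω g = f + ρ` for some `f ∈ L²` and `ρ ∈ Rat₀(𝕋)`, and `T_ω g = ℙ f`. -/
def toeplitz (ω : RatFunc ℂ) : H2 →ₗ.[ℂ] H2 := (toeplitzGraph ω).toLinearPMap

theorem mem_graph_toeplitz_iff (ω : RatFunc ℂ) (x : H2 × H2) :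
    x ∈ (toeplitz ω).graph ↔ x ∈ toeplitzGraph ω := by
  unfold toeplitz
  rw [Submodule.toLinearPMap_graph_eq _ (toeplitzGraph_functional ω)]

/-! ### Unbounded operators on a Hilbert space -/

section Operators

variable {H : Type*} [NormedAddCommGroup H] [InnerProductSpace ℂ H]

/-- A (possibly unbounded) operator is symmetric if it is densely defined and
`⟪A x, y⟫ = ⟪x, A y⟫` for all `x`, `y` in its domain. -/
def IsSymmetricOp (A : H →ₗ.[ℂ] H) : Prop :=
  Dense (A.domain : Set H) ∧ ∀ x y : A.domain, inner ℂ (A x) (y : H) = inner ℂ (x : H) (A y)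

/-- A (possibly unbounded) operator is Fredholm if it is closed, has finite dimensional kernel,
and has closed range of finite codimension. -/
def IsFredholmOp (A : H →ₗ.[ℂ] H) : Prop :=
  A.IsClosed ∧
  FiniteDimensional ℂ (LinearMap.ker A.toFun) ∧
  IsClosed (LinearMap.range A.toFun : Set H) ∧
  FiniteDimensional ℂ (H ⧸ LinearMap.range A.toFun)

/-- The operator `A - c I`, with the same domain as `A`. -/
def subScalar (A : H →ₗ.[ℂ] H) (c : ℂ) : H →ₗ.[ℂ] H where
  domain := A.domain
  toFun := A.toFun - c • A.domain.subtype

/-- The essential spectrum: the complex numbers `c` such that `A - c I` is not Fredholm. -/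
def essSpectrum (A : H →ₗ.[ℂ] H) : Set ℂ := {c | ¬ IsFredholmOp (subScalar A c)}

end Operators

/-! ### The inverse Cayley transform -/

/-- The inverse Cayley transform `z ↦ -i (z + 1) / (z - 1)`, for `z ≠ 1`. -/
def invCayley (z : ℂ) : ℂ := -Complex.I * ((z + 1) / (z - 1))

/-- The rational function `τ` with real coefficients has poles only on the real line. -/
def PolesOnReal (τ : RatFunc ℝ) : Prop := ∀ w : ℂ, τ.denom.aeval w = 0 → w.im = 0

/-- The identity of rational functions `ω(z) = τ(-i (z + 1) / (z - 1))`, expressed through values: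
it holds wherever both sides are defined, that is, for all but finitely many `z`. -/
def EqCompInvCayley (ω : RatFunc ℂ) (τ : RatFunc ℝ) : Prop :=
  ∀ z : ℂ, z ≠ 1 → ¬ IsPole ω z → τ.denom.aeval (invCayley z) ≠ 0 →
    val ω z = τ.eval (algebraMap ℝ ℂ) (invCayley z)

/-! ### Self-inversive polynomials -/

/-- The polynomial `r♯(z) = z ^ k * conj (r (1 / conj z))` with `k = deg r`, that is, the
polynomial with coefficients `conj r_k, …, conj r_1, conj r_0`. -/
def sharp (r : ℂ[X]) : ℂ[X] := (r.map (starRingEnd ℂ)).reverse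

/-- A polynomial `r ≠ 0` is self-inversive if `r = γ r♯` for some constant `γ`. -/
def SelfInversive (r : ℂ[X]) : Prop := r ≠ 0 ∧ ∃ γ : ℂ, r = C γ * sharp r

end ToeplitzLike

end

open ToeplitzLike

noncomputable section

namespace ToeplitzLike

local notation "𝔪" => @AddCircle.haarAddCircle (1 : ℝ) _

/-! ### Multiplication by continuous functions and Fourier coefficients -/

/-! Let m = deg q. Everything rests on `mem_toeplitzGraph_iff`: (g, k) is in the graph of T_ω
exactly when s g - q k is a polynomial of degree < m. This holds because a nonzero strictly proper
rational function with poles on the circle is never square integrable. The property `HasQuotGraph`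
records this description; subtracting c from the operator replaces s by s - c q.

The roots of q lie on the circle, so z^m conj(q) = c q there, with c ≠ 0. Hence q H² is dense, it
lies in the domain of the adjoint, and the adjoint sends q u to ℙ(conj(c) z^m conj(s) u). Symmetry
tested on q H² compares all Fourier coefficients of s conj(q) and conj(s) q, so these functions
agree (`RealOnCircle`). Conversely, if (g, v) is in the graph of the adjoint, then conj(q) v -
conj(s) g has no coefficients of index ≥ 0. Multiplied by z^m, and with realness, this says that c
(q v - s g) has none of index ≥ m, so (g, v) is in the graph of T_ω. Thus the adjoint is contained
in T_ω (`HasQuotGraph.adjoint_le`), and its symmetry follows.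

The essential spectrum is ω(𝕋) (`essSpectrum_toeplitz`). If s has no zero on the circle, s H² is
closed of finite codimension and T_{s/q} is Fredholm. If s(α) = 0 with |α| = 1, the range cannot
have finite codimension, because (z - α) H² is dense but not closed.

The remaining conditions restate realness on the circle: as the polynomial identity c z^n s = z^m s♯
with n = deg s (`realOnCircle_iff_selfInversive`), and as realness on the line after a Cayley
transform (`exists_real_ratFunc`, `realOnCircle_of_eqCompInvCayley`). -/

/-- Multiplication by a continuous function on `L²` of the circle. -/
def mulC (w : C(UnitAddCircle, ℂ)) : L2 →L[ℂ] L2 :=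
  LinearMap.mkContinuous
    { toFun := fun f => (memLp_continuous_mul w.continuous f).toLp _
      map_add' := by
        intro f g
        apply Lp.ext
        filter_upwards [(memLp_continuous_mul w.continuous (f + g)).coeFn_toLp,
          (memLp_continuous_mul w.continuous f).coeFn_toLp,
          (memLp_continuous_mul w.continuous g).coeFn_toLp, Lp.coeFn_add f g,
          Lp.coeFn_add ((memLp_continuous_mul w.continuous f).toLp _)
            ((memLp_continuous_mul w.continuous g).toLp _)] with t h1 h2 h3 h4 h5
        rw [h1, h5, Pi.add_apply, h2, h3, h4, Pi.add_apply, mul_add]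
      map_smul' := by
        intro c f
        apply Lp.ext
        filter_upwards [(memLp_continuous_mul w.continuous (c • f)).coeFn_toLp,
          (memLp_continuous_mul w.continuous f).coeFn_toLp, Lp.coeFn_smul c f,
          Lp.coeFn_smul c ((memLp_continuous_mul w.continuous f).toLp _)] with t h1 h2 h3 h4
        rw [h1, RingHom.id_apply, h4, Pi.smul_apply, h2, h3, Pi.smul_apply]
        simp only [smul_eq_mul]
        ring }
    ‖w‖ (by
      intro f
      apply Lp.norm_le_mul_norm_of_ae_le_mul
      filter_upwards [(memLp_continuous_mul w.continuous f).coeFn_toLp] with t h1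
      refine (congrArg norm h1).le.trans ?_
      rw [norm_mul]
      exact mul_le_mul_of_nonneg_right (w.norm_coe_le_norm t) (norm_nonneg _))

theorem coeFn_mulC (w : C(UnitAddCircle, ℂ)) (f : L2) :
    ∀ᵐ t ∂𝔪, mulC w f t = w t * f t :=
  (memLp_continuous_mul w.continuous f).coeFn_toLp

theorem mulC_mulC (w v : C(UnitAddCircle, ℂ)) (f : L2) :
    mulC w (mulC v f) = mulC (w * v) f := by
  apply Lp.ext
  filter_upwards [coeFn_mulC w (mulC v f), coeFn_mulC v f, coeFn_mulC (w * v) f] with t h1 h2 h3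
  rw [h1, h2, h3, ContinuousMap.mul_apply, mul_assoc]

theorem mulC_sub (w v : C(UnitAddCircle, ℂ)) (f : L2) :
    mulC (w - v) f = mulC w f - mulC v f := by
  apply Lp.ext
  filter_upwards [coeFn_mulC w f, coeFn_mulC v f, coeFn_mulC (w - v) f,
    Lp.coeFn_sub (mulC w f) (mulC v f)] with t h1 h2 h3 h4
  rw [h3, h4, Pi.sub_apply, h1, h2, ContinuousMap.sub_apply, sub_mul]

theorem mulC_add (w v : C(UnitAddCircle, ℂ)) (f : L2) :
    mulC (w + v) f = mulC w f + mulC v f := by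
  rw [← sub_eq_iff_eq_add, ← mulC_sub, add_sub_cancel_right]

theorem mulC_smul (c : ℂ) (w : C(UnitAddCircle, ℂ)) (f : L2) :
    mulC (c • w) f = c • mulC w f := by
  apply Lp.ext
  filter_upwards [coeFn_mulC w f, coeFn_mulC (c • w) f, Lp.coeFn_smul c (mulC w f)]
    with t h1 h2 h3
  rw [h2, h3, Pi.smul_apply, h1, ContinuousMap.smul_apply, smul_eq_mul, smul_eq_mul, mul_assoc]

@[simp] theorem mulC_one (f : L2) : mulC 1 f = f := by
  apply Lp.ext
  filter_upwards [coeFn_mulC 1 f] with t h1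
  rw [h1, ContinuousMap.one_apply, one_mul]

theorem inner_mulC_left (w : C(UnitAddCircle, ℂ)) (f g : L2) :
    inner ℂ (mulC w f) g = inner ℂ f (mulC (star w) g) := by
  rw [L2.inner_def, L2.inner_def]
  apply integral_congr_ae
  filter_upwards [coeFn_mulC w f, coeFn_mulC (star w) g] with t h1 h2
  rw [h1, h2]
  simp only [RCLike.inner_apply, ContinuousMap.star_apply, map_mul, RCLike.star_def]
  ring

theorem inner_mulC_right (w : C(UnitAddCircle, ℂ)) (f g : L2) :
    inner ℂ f (mulC w g) = inner ℂ (mulC (star w) f) g := by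
  rw [inner_mulC_left, star_star]

/-- The Fourier coefficient of index `n` as a continuous linear functional. -/
def coef (n : ℤ) : L2 →L[ℂ] ℂ := innerSL ℂ (fourierBasis n : L2)

theorem coef_apply (n : ℤ) (f : L2) : coef n f = inner ℂ (fourierBasis n : L2) f := rfl

theorem coef_eq_fourierCoeff (n : ℤ) (f : L2) :
    coef n f = fourierCoeff (f : UnitAddCircle → ℂ) n := by
  rw [← fourierBasis_repr, HilbertBasis.repr_apply_apply, coef_apply]

theorem ext_coef {f g : L2} (h : ∀ n, coef n f = coef n g) : f = g := by
  apply fourierBasis.repr.injective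
  ext n
  rw [HilbertBasis.repr_apply_apply, HilbertBasis.repr_apply_apply]
  exact h n

theorem mem_H2_iff {f : L2} : f ∈ H2 ↔ ∀ n : ℤ, n < 0 → coef n f = 0 := by
  simp only [coef_eq_fourierCoeff]
  rfl

theorem coeFn_fourierBasis (n : ℤ) : ∀ᵐ t ∂𝔪, (fourierBasis n : L2) t = fourier n t := by
  rw [coe_fourierBasis]
  exact coeFn_fourierLp 2 n

theorem coef_fourierBasis (n k : ℤ) :
    coef n (fourierBasis k : L2) = if n = k then 1 else 0 :=
  orthonormal_iff_ite.mp fourierBasis.orthonormal n k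

theorem star_fourier (n : ℤ) : star (fourier n : C(UnitAddCircle, ℂ)) = fourier (-n) := by
  ext t
  simp

theorem fourier_mul_fourier (n k : ℤ) :
    (fourier n * fourier k : C(UnitAddCircle, ℂ)) = fourier (n + k) := by
  ext t
  rw [ContinuousMap.mul_apply, fourier_add]

theorem fourier_zero_eq_one : (fourier 0 : C(UnitAddCircle, ℂ)) = 1 := by
  ext t
  simp

theorem mulC_fourier_fourierBasis (k n : ℤ) :
    mulC (fourier k) (fourierBasis n : L2) = (fourierBasis (k + n) : L2) := by
  apply Lp.ext
  filter_upwards [coeFn_mulC (fourier k) (fourierBasis n : L2), coeFn_fourierBasis n,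
    coeFn_fourierBasis (k + n)] with t h1 h2 h3
  rw [h1, h2, h3, fourier_add]

theorem coef_mulC_fourier (k n : ℤ) (f : L2) :
    coef n (mulC (fourier k) f) = coef (n - k) f := by
  rw [coef_apply, inner_mulC_right, star_fourier, mulC_fourier_fourierBasis, coef_apply,
    neg_add_eq_sub]

/-! ### Multiplication by polynomials -/

/-- A polynomial as a continuous function on the circle. -/
def polyC : ℂ[X] →ₐ[ℂ] C(UnitAddCircle, ℂ) := aeval (fourier 1)

theorem polyC_apply (p : ℂ[X]) (t : UnitAddCircle) : polyC p t = p.eval (pt t) := by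
  have h : ((ContinuousMap.evalAlgHom ℂ ℂ t).comp polyC) = aeval (pt t) := by
    ext
    simp [polyC, pt]
  have h1 := congrArg (fun φ : ℂ[X] →ₐ[ℂ] ℂ => φ p) h
  simpa [coe_aeval_eq_eval] using h1

theorem polyC_X_pow (k : ℕ) : polyC (X ^ k) = fourier (k : ℤ) := by
  ext t
  rw [polyC_apply, eval_pow, eval_X, fourier_apply, pt, natCast_zsmul,
    AddCircle.toCircle_nsmul, Circle.coe_pow]

theorem polyC_C_mul (c : ℂ) (p : ℂ[X]) : polyC (C c * p) = c • polyC p := by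
  rw [← smul_eq_C_mul, map_smul]

theorem mulC_polyC_mem_H2 (p : ℂ[X]) {f : L2} (hf : f ∈ H2) : mulC (polyC p) f ∈ H2 := by
  induction p using Polynomial.induction_on' with
  | add p q hp hq =>
    rw [map_add, mulC_add]
    exact H2.add_mem hp hq
  | monomial k a =>
    rw [← C_mul_X_pow_eq_monomial, polyC_C_mul, mulC_smul]
    refine H2.smul_mem _ (mem_H2_iff.mpr fun n hn => ?_)
    rw [polyC_X_pow, coef_mulC_fourier]
    exact mem_H2_iff.mp hf _ (by omega)

/-- Multiplication by a polynomial on `H²`. -/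
def mulPoly (p : ℂ[X]) : H2 →L[ℂ] H2 :=
  ((mulC (polyC p)).comp H2.subtypeL).codRestrict H2 fun x => mulC_polyC_mem_H2 p x.2

@[simp] theorem coe_mulPoly (p : ℂ[X]) (x : H2) :
    (mulPoly p x : L2) = mulC (polyC p) (x : L2) := rfl

theorem mulPoly_mul (p q : ℂ[X]) (x : H2) : mulPoly (p * q) x = mulPoly p (mulPoly q x) := by
  ext1
  simp only [coe_mulPoly, mulC_mulC, map_mul]

theorem mulPoly_add (p q : ℂ[X]) (x : H2) : mulPoly (p + q) x = mulPoly p x + mulPoly q x := by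
  ext1
  simp only [coe_mulPoly, map_add, mulC_add, Submodule.coe_add]

theorem mulPoly_sub (p q : ℂ[X]) (x : H2) : mulPoly (p - q) x = mulPoly p x - mulPoly q x := by
  ext1
  simp only [coe_mulPoly, map_sub, mulC_sub, Submodule.coe_sub]

theorem mulPoly_C_mul (c : ℂ) (p : ℂ[X]) (x : H2) : mulPoly (C c * p) x = c • mulPoly p x := by
  ext1
  simp only [coe_mulPoly, polyC_C_mul, mulC_smul, Submodule.coe_smul]

@[simp] theorem mulPoly_one (x : H2) : mulPoly 1 x = x := by
  ext1
  simp

/-- The constant function `1` in `H²`. -/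
def oneH2 : H2 := ⟨fourierBasis 0, mem_H2_iff.mpr fun n hn => by
  rw [coef_fourierBasis, if_neg hn.ne]⟩

/-- A polynomial as an element of `H²`. -/
def polyH : ℂ[X] →ₗ[ℂ] H2 where
  toFun p := mulPoly p oneH2
  map_add' p q := mulPoly_add p q _
  map_smul' c p := by rw [smul_eq_C_mul, mulPoly_C_mul, RingHom.id_apply]

theorem polyH_apply (p : ℂ[X]) : polyH p = mulPoly p oneH2 := rfl

theorem mulPoly_polyH (p r : ℂ[X]) : mulPoly p (polyH r) = polyH (p * r) := by
  rw [polyH_apply, polyH_apply, mulPoly_mul]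

theorem coe_polyH_X_pow (k : ℕ) : (polyH (X ^ k) : L2) = (fourierBasis (k : ℤ) : L2) := by
  rw [polyH_apply, coe_mulPoly, polyC_X_pow, oneH2, mulC_fourier_fourierBasis, add_zero]

theorem coeFn_polyH (p : ℂ[X]) : ∀ᵐ t ∂𝔪, (polyH p : L2) t = p.eval (pt t) := by
  filter_upwards [coeFn_mulC (polyC p) (fourierBasis 0 : L2), coeFn_fourierBasis 0] with t h1 h2
  rw [polyH_apply, coe_mulPoly]
  refine h1.trans ?_
  rw [h2, fourier_zero, mul_one, polyC_apply]

theorem coef_polyH (p : ℂ[X]) (n : ℕ) : coef n (polyH p : L2) = p.coeff n := by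
  induction p using Polynomial.induction_on' with
  | add p q hp hq => rw [map_add, Submodule.coe_add, map_add, hp, hq, coeff_add]
  | monomial k a =>
    rw [← C_mul_X_pow_eq_monomial, ← smul_eq_C_mul, map_smul, Submodule.coe_smul, map_smul,
      coe_polyH_X_pow, coef_fourierBasis, smul_eq_C_mul, coeff_C_mul, coeff_X_pow]
    simp

/-- The polynomials of degree less than `m`, as a subspace of `H²`. -/
def polyLT (m : ℕ) : Submodule ℂ H2 := (degreeLT ℂ m).map polyH

instance (m : ℕ) : FiniteDimensional ℂ (polyLT m) := by
  have : FiniteDimensional ℂ (degreeLT ℂ m) := (degreeLTEquiv ℂ m).symm.finiteDimensional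
  unfold polyLT
  infer_instance

theorem ext_H2 {x y : H2} (h : ∀ n : ℕ, coef n (x : L2) = coef n (y : L2)) : x = y := by
  refine Subtype.ext (ext_coef fun n => ?_)
  rcases lt_or_ge n 0 with hn | hn
  · rw [mem_H2_iff.mp x.2 n hn, mem_H2_iff.mp y.2 n hn]
  · lift n to ℕ using hn
    exact h n

theorem mem_polyLT_iff {m : ℕ} {x : H2} :
    x ∈ polyLT m ↔ ∀ n : ℕ, m ≤ n → coef n (x : L2) = 0 := by
  constructor
  · rintro ⟨p, hp, rfl⟩ n hn
    rw [coef_polyH]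
    exact coeff_eq_zero_of_degree_lt ((mem_degreeLT.mp hp).trans_le (by exact_mod_cast hn))
  · intro h
    have hc : ∀ n : ℕ, (∑ k ∈ Finset.range m, monomial k (coef k (x : L2))).coeff n =
        if n < m then coef n (x : L2) else 0 := by
      intro n
      rw [finsetSum_coeff]
      simp [coeff_monomial]
    refine ⟨∑ k ∈ Finset.range m, monomial k (coef k (x : L2)), ?_, ?_⟩
    · refine mem_degreeLT.mpr ((degree_lt_iff_coeff_zero _ _).mpr fun n hn => ?_)
      rw [hc, if_neg (not_lt.mpr hn)]
    · refine ext_H2 fun n => ?_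
      rw [coef_polyH, hc]
      split_ifs with hn
      · rfl
      · exact (h n (not_lt.mp hn)).symm

theorem mem_polyLT {m : ℕ} {x : H2} :
    x ∈ polyLT m ↔ ∃ p : ℂ[X], p.degree < m ∧ polyH p = x := by
  simp only [polyLT, Submodule.mem_map, mem_degreeLT]

/-! ### Quotients of polynomials -/

theorem isPole_div_iff {s q : ℂ[X]} (hq : q ≠ 0) (hsq : IsCoprime s q) (z : ℂ) :
    IsPole (algebraMap ℂ[X] (RatFunc ℂ) s / algebraMap ℂ[X] (RatFunc ℂ) q) z ↔
      q.eval z = 0 := by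
  set ω := algebraMap ℂ[X] (RatFunc ℂ) s / algebraMap ℂ[X] (RatFunc ℂ) q with hω
  have h := (RatFunc.num_mul_eq_mul_denom_iff (x := ω) (p := s) hq).mpr rfl
  have h1 : q ∣ ω.denom := hsq.symm.dvd_of_dvd_mul_left (h ▸ Dvd.intro_left _ rfl)
  have h2 : ω.denom ∣ q := RatFunc.denom_div_dvd s q
  exact ⟨fun hz => eval_eq_zero_of_dvd_of_eval_eq_zero h2 hz,
    fun hz => eval_eq_zero_of_dvd_of_eval_eq_zero h1 hz⟩

theorem val_div {s q : ℂ[X]} {z : ℂ} (hz : q.eval z ≠ 0) :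
    val (algebraMap ℂ[X] (RatFunc ℂ) s / algebraMap ℂ[X] (RatFunc ℂ) q) z =
      s.eval z / q.eval z := by
  have hq : q ≠ 0 := by
    rintro rfl
    simp at hz
  set ω := algebraMap ℂ[X] (RatFunc ℂ) s / algebraMap ℂ[X] (RatFunc ℂ) q with hω
  have h := (RatFunc.num_mul_eq_mul_denom_iff (x := ω) (p := s) hq).mpr rfl
  have h2 : ω.denom.eval z ≠ 0 := fun h0 =>
    hz (eval_eq_zero_of_dvd_of_eval_eq_zero (RatFunc.denom_div_dvd s q) h0)
  have h3 := congrArg (Polynomial.eval z) h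
  rw [eval_mul, eval_mul] at h3
  rw [val, RatFunc.eval, eval₂_id, eval₂_id, div_eq_div_iff h2 hz, h3]

theorem ae_eval_ne_zero {q : ℂ[X]} (hq : q ≠ 0) : ∀ᵐ t ∂𝔪, q.eval (pt t) ≠ 0 := by
  filter_upwards [ae_not_isPole (algebraMap ℂ[X] (RatFunc ℂ) 1 / algebraMap ℂ[X] (RatFunc ℂ) q)]
    with t ht
  rwa [isPole_div_iff hq isCoprime_one_left] at ht

theorem div_mem_Rat0T {p q : ℂ[X]} (hq : q ≠ 0) (hroots : ∀ z, q.eval z = 0 → ‖z‖ = 1)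
    (hp : p.degree < q.degree) :
    algebraMap ℂ[X] (RatFunc ℂ) p / algebraMap ℂ[X] (RatFunc ℂ) q ∈ Rat0T := by
  refine ⟨fun z hz => hroots z
    (eval_eq_zero_of_dvd_of_eval_eq_zero (RatFunc.denom_div_dvd p q) hz), ?_⟩
  rwa [strictlyProper_iff hq ((RatFunc.num_mul_eq_mul_denom_iff hq).mpr rfl).symm]

/-- A square integrable function that is a strictly proper quotient of polynomials with poles on
the circle vanishes. -/
theorem eq_zero_of_mulC_eq_polyH {D p : ℂ[X]} (hD : D ≠ 0) (hroots : ∀ z, D.eval z = 0 → ‖z‖ = 1)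
    (hp : p.degree < D.degree) {u : L2} (h : mulC (polyC D) u = polyH p) : u = 0 := by
  have hae : ∀ᵐ t ∂𝔪, val (algebraMap ℂ[X] (RatFunc ℂ) p / algebraMap ℂ[X] (RatFunc ℂ) D) (pt t) =
      u t := by
    filter_upwards [ae_eval_ne_zero hD, coeFn_mulC (polyC D) u, coeFn_polyH p] with t h1 h2 h3
    rw [h, polyC_apply] at h2
    rw [val_div h1, ← h3, h2, mul_div_cancel_left₀ _ h1]
  have h0 := eq_zero_of_ae_eq (div_mem_Rat0T hD hroots hp) u hae
  apply Lp.ext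
  filter_upwards [hae, Lp.coeFn_zero ℂ 2 𝔪] with t h1 h2
  rw [h2, ← h1, h0]
  simp [val]

theorem polyH_injective : Function.Injective polyH := fun p q h => by
  ext n
  rw [← coef_polyH, ← coef_polyH, h]

theorem mulC_polyC_injective {D : ℂ[X]} (hD : D ≠ 0) : Function.Injective (mulC (polyC D)) := by
  intro u v h
  apply Lp.ext
  filter_upwards [ae_eval_ne_zero hD, coeFn_mulC (polyC D) u, coeFn_mulC (polyC D) v]
    with t h1 h2 h3
  rw [h, h3, polyC_apply] at h2
  exact (mul_left_cancel₀ h1 h2).symm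

theorem mulPoly_injective {D : ℂ[X]} (hD : D ≠ 0) : Function.Injective (mulPoly D) :=
  fun _ _ h => Subtype.ext (mulC_polyC_injective hD (congrArg Subtype.val h))

theorem coef_mulC_polyC (p : ℂ[X]) (f : L2) (n : ℤ) :
    coef n (mulC (polyC p) f) = p.sum fun k a => a * coef (n - k) f := by
  induction p using Polynomial.induction_on' with
  | add p q hp hq =>
    rw [map_add, mulC_add, map_add, hp, hq, sum_add_index _ _ _ (by simp) (by intros; ring)]
  | monomial k a =>
    rw [sum_monomial_index _ _ (by simp), ← C_mul_X_pow_eq_monomial, polyC_C_mul, mulC_smul,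
      map_smul, polyC_X_pow, coef_mulC_fourier, smul_eq_mul]

theorem coef_mulC_polyC_eq_zero (p : ℂ[X]) {f : L2} {a : ℤ} (hf : ∀ n, a ≤ n → coef n f = 0)
    {n : ℤ} (hn : a + p.natDegree ≤ n) : coef n (mulC (polyC p) f) = 0 := by
  rw [coef_mulC_polyC]
  refine Finset.sum_eq_zero fun k hk => ?_
  have := le_natDegree_of_mem_supp k hk
  simp only [hf (n - k) (by omega), mul_zero]

/-! ### The graph of `T_{s/q}` described by polynomials -/

theorem coef_eq_zero_of_rieszProj {u : L2} (h : rieszProj u = 0) {n : ℤ} (hn : 0 ≤ n) :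
    coef n u = 0 := by
  have h1 : u ∈ H2ᗮ := Submodule.orthogonalProjectionOnto_eq_zero_iff.mp h
  refine (Submodule.mem_orthogonal H2 u).mp h1 _ (mem_H2_iff.mpr fun k hk => ?_)
  rw [coef_fourierBasis, if_neg (by omega)]

theorem rieszProj_coe (x : H2) : rieszProj (x : L2) = x :=
  Submodule.orthogonalProjectionOnto_mem_subspace_eq_self x

/-- If `η` has no Fourier coefficients of nonnegative index and `D η ∈ H²` for a polynomial `D`
with roots on the circle, then `η = 0`. -/
theorem eq_zero_of_mulC_mem_H2 {D : ℂ[X]} (hD : D ≠ 0) (hroots : ∀ z, D.eval z = 0 → ‖z‖ = 1)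
    {u : L2} (hu : ∀ n : ℤ, 0 ≤ n → coef n u = 0) (h : mulC (polyC D) u ∈ H2) : u = 0 := by
  -- `u` has top index at most -1, so `D u` has top index below deg `D`. Being in `H²`, it is a
  -- polynomial, and `u` is a strictly proper quotient.
  have h1 : (⟨_, h⟩ : H2) ∈ polyLT D.natDegree :=
    mem_polyLT_iff.mpr fun n hn => coef_mulC_polyC_eq_zero D hu (by omega)
  obtain ⟨p, hp, hpu⟩ := mem_polyLT.mp h1
  rw [← degree_eq_natDegree hD] at hp
  exact eq_zero_of_mulC_eq_polyH hD hroots hp (congrArg Subtype.val hpu).symm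

/-- The graph of `T_ω` for `ω = s / q`: it consists of the pairs `(g, k)` for which `s g - q k` is
a polynomial of degree less than `deg q`. -/
theorem mem_toeplitzGraph_iff {s q : ℂ[X]} (hq : q ≠ 0) (hroots : ∀ z, q.eval z = 0 → ‖z‖ = 1)
    (x : H2 × H2) :
    x ∈ toeplitzGraph (algebraMap ℂ[X] (RatFunc ℂ) s / algebraMap ℂ[X] (RatFunc ℂ) q) ↔
      mulPoly s x.1 - mulPoly q x.2 ∈ polyLT q.natDegree := by
  constructor
  · rintro ⟨f, ρ, hρ, hf, hx⟩
    have hR0 := ρ.denom_ne_zero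
    have hD : ∀ᵐ t ∂𝔪, ρ.denom.eval (pt t) * (s.eval (pt t) * (x.1 : L2) t -
        q.eval (pt t) * f t) = (q * ρ.num).eval (pt t) := by
      filter_upwards [hf, ae_not_isPole ρ, ae_eval_ne_zero hq] with t h1 h2 h3
      have h2' : ρ.denom.eval (pt t) ≠ 0 := h2
      rw [val_div h3, val, RatFunc.eval, eval₂_id, eval₂_id] at h1
      rw [eval_mul]
      field_simp at h1
      linear_combination h1
    -- Clearing the denominators of ω and ρ shows that a polynomial multiple of `f` lies in `H²`.
    have hmul : mulC (polyC (ρ.denom * q)) f =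
        (mulPoly (ρ.denom * s) x.1 - polyH (q * ρ.num) : H2) := by
      apply Lp.ext
      filter_upwards [hD, coeFn_mulC (polyC (ρ.denom * q)) f,
        coeFn_mulC (polyC (ρ.denom * s)) x.1, coeFn_polyH (q * ρ.num),
        Lp.coeFn_sub (mulPoly (ρ.denom * s) x.1 : L2) (polyH (q * ρ.num) : L2)]
        with t h1 h2 h3 h4 h5
      rw [Submodule.coe_sub, h5, Pi.sub_apply, h2, coe_mulPoly, h3, h4, ← h1]
      simp only [polyC_apply, eval_mul]
      ring
    -- The part of `f` of negative index vanishes, so `f` is already in `H²` and equals its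
    -- projection.
    have hf2 : f - (x.2 : L2) = 0 := by
      refine eq_zero_of_mulC_mem_H2 (mul_ne_zero hR0 hq) (fun z hz => ?_)
        (fun n hn => coef_eq_zero_of_rieszProj ?_ hn) ?_
      · rw [eval_mul, mul_eq_zero] at hz
        exact hz.elim (hρ.1 z) (hroots z)
      · rw [map_sub, rieszProj_coe, hx, sub_self]
      · rw [map_sub, hmul]
        exact H2.sub_mem (Subtype.prop _) (mulC_polyC_mem_H2 _ x.2.2)
    rw [sub_eq_zero] at hf2
    rw [hf2] at hD
    set a := mulPoly s x.1 - mulPoly q x.2 with ha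
    have hRa : mulPoly ρ.denom a = polyH (q * ρ.num) := by
      apply Subtype.ext
      apply Lp.ext
      filter_upwards [hD, coeFn_mulC (polyC ρ.denom) a, coeFn_polyH (q * ρ.num),
        coeFn_mulC (polyC s) x.1, coeFn_mulC (polyC q) x.2,
        Lp.coeFn_sub (mulPoly s x.1 : L2) (mulPoly q x.2 : L2)] with t h1 h2 h3 h4 h5 h6
      rw [coe_mulPoly, h2, h3, ← h1, ha, Submodule.coe_sub, h6, Pi.sub_apply, coe_mulPoly,
        coe_mulPoly, h4, h5]
      simp only [polyC_apply]
    -- With `a = A + B / ρ.denom`, the fraction is strictly proper and square integrable, hence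
    -- zero. So `a` is the polynomial `A`.
    have hdiv := EuclideanDomain.div_add_mod (q * ρ.num) ρ.denom
    set A := q * ρ.num / ρ.denom
    set B := q * ρ.num % ρ.denom with hB
    have hBd : B.degree < ρ.denom.degree := degree_mod_lt _ hR0
    have haA : a - polyH A = 0 := by
      apply Subtype.ext
      refine eq_zero_of_mulC_eq_polyH hR0 hρ.1 hBd ?_
      rw [← coe_mulPoly, map_sub, hRa, ← hdiv, mulPoly_polyH, map_add, add_sub_cancel_left]
    rw [sub_eq_zero] at haA
    have hRA : ρ.denom * A = q * ρ.num := polyH_injective (by rw [← hRa, haA, mulPoly_polyH])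
    refine mem_polyLT.mpr ⟨A, ?_, haA.symm⟩
    have h1 := congrArg Polynomial.degree hRA
    rw [degree_mul, degree_mul, add_comm] at h1
    rw [← degree_eq_natDegree hq]
    have h2 : A.degree + ρ.denom.degree < q.degree + ρ.denom.degree := by
      rw [h1]
      exact WithBot.add_lt_add_left (by simpa using hq) hρ.2
    exact lt_of_add_lt_add_right h2
  · intro h
    obtain ⟨p, hp, hpx⟩ := mem_polyLT.mp h
    rw [← degree_eq_natDegree hq] at hp
    refine ⟨x.2, _, div_mem_Rat0T hq hroots hp, ?_, (rieszProj_coe _).symm⟩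
    filter_upwards [ae_eval_ne_zero hq, coeFn_polyH p,
        coeFn_mulC (polyC s) x.1, coeFn_mulC (polyC q) x.2,
        Lp.coeFn_sub (mulPoly s x.1 : L2) (mulPoly q x.2 : L2)] with t h1 h2 h3 h4 h5
    rw [hpx, Submodule.coe_sub, h5, Pi.sub_apply, coe_mulPoly, coe_mulPoly, h3, h4] at h2
    simp only [polyC_apply] at h2
    rw [val_div h1, val_div h1, ← h2]
    field_simp
    ring

/-! ### Polynomials with all roots on the circle -/

/-- Induction on the number of roots of a nonzero complex polynomial. -/
theorem roots_induction {P : ℂ[X] → Prop} (hC : ∀ a : ℂ, a ≠ 0 → P (C a))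
    (hmul : ∀ (α : ℂ) (p : ℂ[X]), p ≠ 0 → P p → P ((X - C α) * p)) (p : ℂ[X]) (hp : p ≠ 0) :
    P p := by
  induction h : p.natDegree generalizing p with
  | zero =>
    rw [eq_C_of_natDegree_eq_zero h] at hp ⊢
    exact hC _ (by simpa using hp)
  | succ n ih =>
    obtain ⟨α, hα⟩ := Complex.exists_root
      (natDegree_pos_iff_degree_pos.mp (by omega : 0 < p.natDegree))
    obtain ⟨r, rfl⟩ := dvd_iff_isRoot.mpr hα
    have hr : r ≠ 0 := right_ne_zero_of_mul hp
    rw [natDegree_mul (X_sub_C_ne_zero α) hr, natDegree_X_sub_C] at h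
    exact hmul α r hr (ih r hr (by omega))

theorem mul_conj_of_norm_eq_one {z : ℂ} (hz : ‖z‖ = 1) : z * conj z = 1 := by
  rw [Complex.mul_conj, Complex.normSq_eq_norm_sq, hz]
  norm_num

/-- For a single factor with |α| = |z| = 1, z conj(z - α) = 1 - z conj(α) = -conj(α) (z - α); these
relations multiply over the roots. -/
theorem exists_conj_eval {q : ℂ[X]} (hq : q ≠ 0) (hroots : ∀ z, q.eval z = 0 → ‖z‖ = 1) :
    ∃ c : ℂ, c ≠ 0 ∧ ∀ z : ℂ, ‖z‖ = 1 → z ^ q.natDegree * conj (q.eval z) = c * q.eval z := by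
  revert hroots
  refine roots_induction (P := fun q => (∀ z, q.eval z = 0 → ‖z‖ = 1) → ∃ c : ℂ, c ≠ 0 ∧
    ∀ z : ℂ, ‖z‖ = 1 → z ^ q.natDegree * conj (q.eval z) = c * q.eval z) ?_ ?_ q hq
  · intro a ha _
    refine ⟨conj a / a, div_ne_zero ((_root_.map_ne_zero _).mpr ha) ha, fun z _ => ?_⟩
    simp only [natDegree_C, eval_C]
    field_simp
  · intro α p hp ih hroots
    obtain ⟨c, hc, h⟩ := ih fun z hz => hroots z (by rw [eval_mul, hz, mul_zero])
    have hα := mul_conj_of_norm_eq_one (hroots α (by simp))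
    refine ⟨-conj α * c, mul_ne_zero (neg_ne_zero.mpr fun h0 => by simp [h0] at hα) hc,
      fun z hz => ?_⟩
    have h1 := mul_conj_of_norm_eq_one hz
    rw [natDegree_mul (X_sub_C_ne_zero α) hp, natDegree_X_sub_C]
    simp only [eval_mul, eval_sub, eval_X, eval_C, map_mul, map_sub]
    calc z ^ (1 + p.natDegree) * ((conj z - conj α) * conj (p.eval z))
        = (z * conj z - z * conj α) * (z ^ p.natDegree * conj (p.eval z)) := by ring
      _ = _ := by
        rw [h z hz, h1]
        linear_combination -c * p.eval z * hα

theorem norm_pt (t : UnitAddCircle) : ‖pt t‖ = 1 := Circle.norm_coe _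

/-- `q` is self-inversive on the circle, with constant `c`. -/
def ConjEq (q : ℂ[X]) (c : ℂ) : Prop :=
  fourier (q.natDegree : ℤ) * star (polyC q) = c • polyC q

theorem exists_conjEq {q : ℂ[X]} (hq : q ≠ 0) (hroots : ∀ z, q.eval z = 0 → ‖z‖ = 1) :
    ∃ c : ℂ, c ≠ 0 ∧ ConjEq q c := by
  obtain ⟨c, hc, h⟩ := exists_conj_eval hq hroots
  refine ⟨c, hc, ?_⟩
  ext t
  rw [← polyC_X_pow]
  simpa [polyC_apply] using h _ (norm_pt t)

theorem fourier_neg_mul_fourier (n : ℤ) :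
    (fourier (-n) * fourier n : C(UnitAddCircle, ℂ)) = 1 := by
  rw [fourier_mul_fourier, neg_add_cancel, fourier_zero_eq_one]

theorem ConjEq.star_eq {q : ℂ[X]} {c : ℂ} (h : ConjEq q c) :
    star (polyC q) = c • (fourier (-(q.natDegree : ℤ)) * polyC q) := by
  rw [← mul_smul_comm, ← h, ← mul_assoc, fourier_neg_mul_fourier, one_mul]

theorem ConjEq.eq_smul {q : ℂ[X]} {c : ℂ} (h : ConjEq q c) :
    polyC q = conj c • (fourier (q.natDegree : ℤ) * star (polyC q)) := by
  have h1 := congrArg star h.star_eq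
  rwa [star_star, star_smul, star_mul', star_fourier, neg_neg] at h1

/-! ### Density of `q H²` -/

theorem inner_eq_zero_of_coef {f g : L2} (h : ∀ n, coef n f = 0 ∨ coef n g = 0) :
    inner ℂ f g = 0 := by
  rw [← fourierBasis.tsum_inner_mul_inner]
  convert tsum_zero with n
  rcases h n with h | h
  · rw [← inner_conj_symm, ← coef_apply, h, map_zero, zero_mul]
  · rw [← coef_apply, h, mul_zero]

/-- Testing against u = z^n reads off the coefficient of index n. The hypothesis is the weak form of
the adjoint relation on the pairs (q u, s u); with s = 0 and g = 0 it is orthogonality to q H². -/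
theorem coef_conj_sub_eq_zero {s q : ℂ[X]} {v g : H2}
    (h : ∀ u : H2, inner ℂ v (mulPoly q u) = inner ℂ g (mulPoly s u)) {n : ℤ} (hn : 0 ≤ n) :
    coef n (mulC (star (polyC q)) v - mulC (star (polyC s)) g) = 0 := by
  lift n to ℕ using hn
  have h1 := h (polyH (X ^ n))
  rw [Submodule.coe_inner, Submodule.coe_inner, coe_mulPoly, coe_mulPoly, coe_polyH_X_pow,
    inner_mulC_right, inner_mulC_right] at h1
  rw [map_sub, coef_apply, coef_apply, ← inner_conj_symm, h1, inner_conj_symm, sub_self]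

/-- If v is orthogonal to q H², then conj(q) v has no coefficients of index ≥ 0. Multiplication by
z^m with m = deg q turns this into q v being a polynomial of degree < m, and then v = 0 by square
integrability. -/
theorem orthogonal_range_mulPoly {q : ℂ[X]} (hq : q ≠ 0)
    (hroots : ∀ z, q.eval z = 0 → ‖z‖ = 1) : (mulPoly q).rangeᗮ = ⊥ := by
  obtain ⟨c, hc, hcq⟩ := exists_conjEq hq hroots
  refine (Submodule.eq_bot_iff _).mpr fun v hv => ?_
  have h1 : ∀ u : H2, inner ℂ v (mulPoly q u) = inner ℂ (0 : H2) (mulPoly 0 u) := fun u => by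
    rw [inner_zero_left]
    exact (Submodule.mem_orthogonal' _ v).mp hv _ ⟨u, rfl⟩
  have h2 : ∀ n : ℕ, q.natDegree ≤ n → coef n (mulPoly q v : L2) = 0 := by
    intro n hn
    have h3 := coef_conj_sub_eq_zero h1 (n := n - q.natDegree) (by omega)
    rw [Submodule.coe_zero, map_zero, sub_zero, ← coef_mulC_fourier, mulC_mulC, hcq, mulC_smul,
      map_smul, smul_eq_mul] at h3
    exact (mul_eq_zero.mp h3).resolve_left hc
  obtain ⟨p, hp, hpv⟩ := mem_polyLT.mp (mem_polyLT_iff.mpr h2)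
  rw [← degree_eq_natDegree hq] at hp
  exact Subtype.ext (eq_zero_of_mulC_eq_polyH hq hroots hp (congrArg Subtype.val hpv).symm)

theorem dense_range_mulPoly {q : ℂ[X]} (hq : q ≠ 0) (hroots : ∀ z, q.eval z = 0 → ‖z‖ = 1) :
    Dense ((mulPoly q).range : Set H2) :=
  Submodule.dense_iff_topologicalClosure_eq_top.mpr
    (Submodule.topologicalClosure_eq_top_iff.mpr (orthogonal_range_mulPoly hq hroots))

/-! ### Operators with the graph of `T_{s/q}` and their adjoints -/

/-- `A` has the graph of the Toeplitz-like operator with symbol `s / q`. -/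
def HasQuotGraph (A : H2 →ₗ.[ℂ] H2) (s q : ℂ[X]) : Prop :=
  ∀ x : H2 × H2, x ∈ A.graph ↔ mulPoly s x.1 - mulPoly q x.2 ∈ polyLT q.natDegree

theorem hasQuotGraph_toeplitz {s q : ℂ[X]} (hq : q ≠ 0) (hroots : ∀ z, q.eval z = 0 → ‖z‖ = 1) :
    HasQuotGraph (toeplitz (algebraMap ℂ[X] (RatFunc ℂ) s / algebraMap ℂ[X] (RatFunc ℂ) q)) s q :=
  fun x => (mem_graph_toeplitz_iff _ x).trans (mem_toeplitzGraph_iff hq hroots x)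

section Adjoint

variable {A : H2 →ₗ.[ℂ] H2} {s q : ℂ[X]}

theorem HasQuotGraph.mulPoly_mem (hA : HasQuotGraph A s q) (u : H2) :
    (mulPoly q u, mulPoly s u) ∈ A.graph := by
  rw [hA]
  simp only
  rw [← mulPoly_mul, ← mulPoly_mul, mul_comm, sub_self]
  exact zero_mem _

theorem HasQuotGraph.dense_domain (hA : HasQuotGraph A s q) (hq : q ≠ 0)
    (hroots : ∀ z, q.eval z = 0 → ‖z‖ = 1) : Dense (A.domain : Set H2) := by
  refine (dense_range_mulPoly hq hroots).mono ?_
  rintro _ ⟨u, rfl⟩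
  exact LinearPMap.mem_domain_iff.mpr ⟨_, hA.mulPoly_mem u⟩

/-- The value of the adjoint of `T_{s/q}` at `q u`. -/
def adjointValue (s q : ℂ[X]) (c : ℂ) (u : H2) : H2 :=
  rieszProj (conj c • mulC (fourier (q.natDegree : ℤ) * star (polyC s)) u)

/-- The remainder s x - q A x has degree < m while z^m u starts at index m = deg q, so they are
orthogonal. Moving s and q across the inner product and using z^m conj(q) = c q gives the formula.
-/
theorem HasQuotGraph.inner_adjointValue (hA : HasQuotGraph A s q) {c : ℂ} (hc : ConjEq q c)
    (u : H2) (x : A.domain) :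
    inner ℂ (adjointValue s q c u) (x : H2) = inner ℂ (mulPoly q u) (A x) := by
  have hx := (hA ((x : H2), A x)).mp (LinearPMap.mem_graph A x)
  simp only at hx
  have h0 : inner ℂ (mulC (fourier (q.natDegree : ℤ)) (u : L2))
      ((mulPoly s x - mulPoly q (A x) : H2) : L2) = 0 := by
    refine inner_eq_zero_of_coef fun n => ?_
    rcases lt_or_ge n q.natDegree with hn | hn
    · left
      rw [coef_mulC_fourier]
      exact mem_H2_iff.mp u.2 _ (by omega)
    · right
      lift n to ℕ using by omega
      exact mem_polyLT_iff.mp hx n (by exact_mod_cast hn)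
  rw [Submodule.coe_sub, inner_sub_right, sub_eq_zero, coe_mulPoly, coe_mulPoly, inner_mulC_left,
    inner_mulC_left, star_fourier, mulC_mulC, mulC_mulC] at h0
  rw [adjointValue, rieszProj, Submodule.inner_orthogonalProjectionOnto_eq_of_mem_right,
    inner_smul_left, Complex.conj_conj, inner_mulC_left, star_mul', star_fourier, star_star, h0,
    Submodule.coe_inner, coe_mulPoly, inner_mulC_left, hc.star_eq, mulC_smul, inner_smul_right]

theorem HasQuotGraph.mulPoly_mem_adjoint (hA : HasQuotGraph A s q) {c : ℂ} (hc : ConjEq q c)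
    (u : H2) : mulPoly q u ∈ A.adjoint.domain :=
  LinearPMap.mem_adjoint_domain_of_exists _ ⟨_, hA.inner_adjointValue hc u⟩

theorem HasQuotGraph.adjoint_apply (hA : HasQuotGraph A s q) (hq : q ≠ 0)
    (hroots : ∀ z, q.eval z = 0 → ‖z‖ = 1) {c : ℂ} (hc : ConjEq q c) (u : H2) :
    A.adjoint ⟨mulPoly q u, hA.mulPoly_mem_adjoint hc u⟩ = adjointValue s q c u :=
  LinearPMap.adjoint_apply_eq (hA.dense_domain hq hroots) _ (hA.inner_adjointValue hc u)

/-- `s / q` is real on the circle. -/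
def RealOnCircle (s q : ℂ[X]) : Prop :=
  polyC s * star (polyC q) = star (polyC s) * polyC q

theorem eq_of_ae_eq {w v : C(UnitAddCircle, ℂ)} (h : ∀ᵐ t ∂𝔪, w t = v t) : w = v := by
  have : (@AddCircle.haarAddCircle (1 : ℝ) _).IsOpenPosMeasure := by
    unfold AddCircle.haarAddCircle
    infer_instance
  exact ContinuousMap.coe_injective
    ((Continuous.ae_eq_iff_eq 𝔪 w.continuous v.continuous).mp h)

theorem HasQuotGraph.realOnCircle (hA : HasQuotGraph A s q) (hq : q ≠ 0)
    (hroots : ∀ z, q.eval z = 0 → ‖z‖ = 1) (h : IsSymmetricOp A.adjoint) : RealOnCircle s q := by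
  obtain ⟨c, -, hc⟩ := exists_conjEq hq hroots
  have key : ∀ u v : H2, inner ℂ (u : L2) (mulC (polyC s * star (polyC q)) (v : L2)) =
      inner ℂ (u : L2) (mulC (star (polyC s) * polyC q) (v : L2)) := by
    intro u v
    have h1 := h.2 ⟨mulPoly q u, hA.mulPoly_mem_adjoint hc u⟩
      ⟨mulPoly q v, hA.mulPoly_mem_adjoint hc v⟩
    rw [hA.adjoint_apply hq hroots hc, hA.adjoint_apply hq hroots hc] at h1
    simp only [adjointValue, rieszProj, Submodule.inner_orthogonalProjectionOnto_eq_of_mem_right,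
      Submodule.inner_orthogonalProjectionOnto_eq_of_mem_left, coe_mulPoly] at h1
    rw [← mulC_smul, ← mulC_smul, inner_mulC_left, inner_mulC_left, mulC_mulC, mulC_mulC] at h1
    convert h1 using 3
    · rw [hc.star_eq, star_smul, star_mul', star_fourier, star_star, RCLike.star_def,
        Complex.conj_conj, smul_mul_assoc, mul_smul_comm]
      congr 2
      ring
    · conv_lhs => rw [hc.eq_smul]
      rw [mul_smul_comm, mul_smul_comm]
      congr 2
      ring
  have hL2 : mulC (polyC s * star (polyC q)) (fourierBasis 0 : L2) =
      mulC (star (polyC s) * polyC q) (fourierBasis 0 : L2) := by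
    refine ext_coef fun n => ?_
    -- The coefficient of `w` at a - b is the matrix entry ⟨z^a, w z^b⟩, so vectors of `H²` also
    -- detect the negative indices.
    obtain ⟨a, b, rfl⟩ : ∃ a b : ℕ, n = a - b := ⟨n.toNat, (-n).toNat, by omega⟩
    have hb : ∀ w : C(UnitAddCircle, ℂ), coef (a - b) (mulC w (fourierBasis 0 : L2)) =
        inner ℂ (polyH (X ^ a) : L2) (mulC w (polyH (X ^ b) : L2)) := by
      intro w
      rw [coe_polyH_X_pow, coe_polyH_X_pow, ← coef_mulC_fourier, mulC_mulC, mul_comm, ← mulC_mulC,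
        mulC_fourier_fourierBasis, add_zero, coef_apply]
    rw [hb, hb]
    exact key _ _
  refine eq_of_ae_eq ?_
  filter_upwards [coeFn_mulC (polyC s * star (polyC q)) (fourierBasis 0 : L2),
    coeFn_mulC (star (polyC s) * polyC q) (fourierBasis 0 : L2), coeFn_fourierBasis 0]
    with t h1 h2 h3
  rw [hL2, h2, h3, fourier_zero, mul_one, mul_one] at h1
  exact h1.symm

theorem HasQuotGraph.adjoint_le (hA : HasQuotGraph A s q) (hq : q ≠ 0)
    (hroots : ∀ z, q.eval z = 0 → ‖z‖ = 1) (h : RealOnCircle s q) : A.adjoint ≤ A := by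
  obtain ⟨c, hc0, hc⟩ := exists_conjEq hq hroots
  refine LinearPMap.le_of_le_graph fun x hx => ?_
  obtain ⟨g, v⟩ := x
  obtain ⟨y, hy1, hy2⟩ := (LinearPMap.mem_graph_iff _).mp hx
  simp only at hy1 hy2
  have hform : ∀ u : H2, inner ℂ v (mulPoly q u) = inner ℂ g (mulPoly s u) := by
    intro u
    obtain ⟨z, hz1, hz2⟩ := (LinearPMap.mem_graph_iff _).mp (hA.mulPoly_mem u)
    simp only at hz1 hz2
    have := LinearPMap.adjoint_isFormalAdjoint (hA.dense_domain hq hroots) y z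
    rwa [hy1, hy2, hz1, hz2] at this
  -- Realness transfers the reflection constant from q to s: z^m conj(s) = c s, after cancelling q,
  -- with m = deg q.
  have hs : mulC (fourier (q.natDegree : ℤ) * star (polyC s)) (g : L2) =
      c • mulC (polyC s) (g : L2) := by
    apply mulC_polyC_injective hq
    rw [← mulC_smul, mulC_mulC, mulC_mulC]
    congr 2
    calc polyC q * (fourier (q.natDegree : ℤ) * star (polyC s))
        = fourier (q.natDegree : ℤ) * (star (polyC s) * polyC q) := by ring
      _ = polyC s * (fourier (q.natDegree : ℤ) * star (polyC q)) := by
        rw [← h]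
        ring
      _ = _ := by rw [hc, mul_smul_comm, mul_smul_comm, mul_comm (polyC s)]
  rw [hA, ← neg_sub, neg_mem_iff, mem_polyLT_iff]
  intro n hn
  have h3 := coef_conj_sub_eq_zero hform (n := n - q.natDegree) (by omega)
  rw [← coef_mulC_fourier, map_sub, mulC_mulC, mulC_mulC, hc, hs, mulC_smul, ← smul_sub, map_smul,
    smul_eq_mul] at h3
  exact (mul_eq_zero.mp h3).resolve_left hc0

/-- Since `A.adjoint ≤ A`, the defining relation of the adjoint can be applied with its second
argument in the smaller domain. -/
theorem HasQuotGraph.isSymmetricOp (hA : HasQuotGraph A s q) (hq : q ≠ 0)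
    (hroots : ∀ z, q.eval z = 0 → ‖z‖ = 1) (h : RealOnCircle s q) : IsSymmetricOp A.adjoint := by
  obtain ⟨c, -, hc⟩ := exists_conjEq hq hroots
  refine ⟨(dense_range_mulPoly hq hroots).mono ?_, fun x y => ?_⟩
  · rintro _ ⟨u, rfl⟩
    exact hA.mulPoly_mem_adjoint hc u
  · have hle := hA.adjoint_le hq hroots h
    have h1 := LinearPMap.adjoint_isFormalAdjoint (hA.dense_domain hq hroots) x ⟨y, hle.1 y.2⟩
    rwa [← hle.2 (x := y) (y := ⟨y, hle.1 y.2⟩) rfl] at h1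

end Adjoint

/-! ### Subspaces of finite codimension -/

section CoFG

variable {E F : Type*} [AddCommGroup E] [Module ℂ E] [AddCommGroup F] [Module ℂ F]

theorem cofg_iff_exists_fg {S : Submodule ℂ E} :
    S.CoFG ↔ ∃ K : Submodule ℂ E, K.FG ∧ S ⊔ K = ⊤ := by
  constructor
  · intro h
    obtain ⟨K, hK⟩ := Submodule.exists_isCompl S
    exact ⟨K, h.fg_of_isCompl hK, hK.sup_eq_top⟩
  · rintro ⟨K, hK, h⟩
    exact hK.cofg_of_codisjoint (codisjoint_iff.mpr (by rw [sup_comm, h]))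

theorem cofg_map {f : E →ₗ[ℂ] F} {S : Submodule ℂ E} (hf : (LinearMap.range f).CoFG)
    (hS : S.CoFG) : (S.map f).CoFG := by
  obtain ⟨K, hK, hSK⟩ := cofg_iff_exists_fg.mp hS
  obtain ⟨L, hL, hfL⟩ := cofg_iff_exists_fg.mp hf
  refine cofg_iff_exists_fg.mpr ⟨K.map f ⊔ L, (hK.map f).sup hL, ?_⟩
  rw [← sup_assoc, ← Submodule.map_sup, hSK, Submodule.map_top, hfL]

theorem cofg_comap (f : E →ₗ[ℂ] F) {S : Submodule ℂ F} (hS : S.CoFG) : (S.comap f).CoFG := by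
  have := hS
  have h := Submodule.CoFG.ker (S.mkQ ∘ₗ f)
  rwa [LinearMap.ker_comp, Submodule.ker_mkQ] at h

theorem cofg_of_sup_fg {S K : Submodule ℂ E} (hK : K.FG) (h : (S ⊔ K).CoFG) : S.CoFG := by
  obtain ⟨L, hL, hSL⟩ := cofg_iff_exists_fg.mp h
  exact cofg_iff_exists_fg.mpr ⟨K ⊔ L, hK.sup hL, by rw [← sup_assoc, hSL]⟩

end CoFG

/-- A finite dimensional algebraic complement is closed, and an injective bounded operator on a
Banach space whose range has a closed complement has closed range. -/
theorem isClosed_range_of_cofg {E : Type*} [NormedAddCommGroup E] [NormedSpace ℂ E]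
    [CompleteSpace E] (f : E →L[ℂ] E) (hf : Function.Injective f) (h : f.range.CoFG) :
    IsClosed (f.range : Set E) := by
  obtain ⟨G, hG⟩ := Submodule.exists_isCompl f.range
  have : FiniteDimensional ℂ G := Module.Finite.iff_fg.mpr (h.fg_of_isCompl hG)
  exact f.closed_complemented_range_of_isCompl_of_ker_eq_bot G hG G.closed_of_finiteDimensional
    (LinearMap.ker_eq_bot.mpr hf)

theorem exists_sub_smul_apply_eq {E : Type*} [NormedAddCommGroup E] [NormedSpace ℂ E]
    [CompleteSpace E] {T : E →L[ℂ] E} (hT : ‖T‖ ≤ 1) {c : ℂ} (hc : ‖c‖ < 1) (y : E) :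
    ∃ x, x - c • T x = y := by
  have hnorm : ‖c • T‖ < 1 := by
    rw [norm_smul]
    exact (mul_le_of_le_one_right (norm_nonneg _) hT).trans_lt hc
  obtain ⟨U, hU⟩ := isUnit_one_sub_of_norm_lt_one hnorm
  refine ⟨(↑U⁻¹ : E →L[ℂ] E) y, ?_⟩
  change (1 - c • T) ((↑U⁻¹ : E →L[ℂ] E) y) = y
  rw [← hU, ← mul_apply_eq_comp, U.mul_inv, one_apply_eq_self]

/-! ### Ranges of multiplication operators on `H²` -/

theorem mulC_fourier_norm_le (k : ℤ) (f : L2) : ‖mulC (fourier k) f‖ ≤ ‖f‖ := by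
  have h := (mulC (fourier k)).le_of_opNorm_le
    (LinearMap.mkContinuous_norm_le _ (norm_nonneg (fourier k : C(UnitAddCircle, ℂ))) _) f
  rwa [fourier_norm, one_mul] at h

theorem norm_mulPoly_X_le : ‖mulPoly X‖ ≤ 1 := by
  refine ContinuousLinearMap.opNorm_le_bound _ zero_le_one fun x => ?_
  rw [one_mul, ← pow_one (X : ℂ[X]), Submodule.coe_norm, coe_mulPoly, polyC_X_pow]
  exact mulC_fourier_norm_le _ _

theorem mulPoly_C (a : ℂ) (x : H2) : mulPoly (C a) x = a • x := by
  rw [← mul_one (C a), mulPoly_C_mul, mulPoly_one]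

theorem mulPoly_X_sub_C (α : ℂ) (x : H2) : mulPoly (X - C α) x = mulPoly X x - α • x := by
  rw [mulPoly_sub, mulPoly_C]

theorem coef_mulPoly_X_succ (n : ℕ) (x : H2) :
    coef (n + 1 : ℕ) (mulPoly X x : L2) = coef n (x : L2) := by
  rw [← pow_one (X : ℂ[X]), coe_mulPoly, polyC_X_pow, coef_mulC_fourier]
  congr 2
  push_cast
  ring

theorem coef_mulPoly_X_zero (x : H2) : coef (0 : ℕ) (mulPoly X x : L2) = 0 := by
  rw [← pow_one (X : ℂ[X]), coe_mulPoly, polyC_X_pow, coef_mulC_fourier]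
  exact mem_H2_iff.mp x.2 _ (by norm_num)

theorem coef_eq_inner (n : ℕ) (x : H2) : coef n (x : L2) = inner ℂ (polyH (X ^ n)) x := by
  rw [Submodule.coe_inner, coe_polyH_X_pow, coef_apply]

theorem coef_adjoint_mulPoly_X (n : ℕ) (x : H2) :
    coef n (ContinuousLinearMap.adjoint (mulPoly X) x : L2) = coef (n + 1 : ℕ) (x : L2) := by
  rw [coef_eq_inner, ContinuousLinearMap.adjoint_inner_right, mulPoly_polyH, coef_eq_inner,
    pow_succ']

/-- The shift composed with the backward shift removes the constant term. -/
theorem mulPoly_X_adjoint (x : H2) :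
    mulPoly X (ContinuousLinearMap.adjoint (mulPoly X) x) = x - coef (0 : ℕ) (x : L2) • oneH2 := by
  refine ext_H2 fun n => ?_
  have h1 : oneH2 = polyH 1 := by rw [polyH_apply, mulPoly_one]
  rw [Submodule.coe_sub, map_sub, Submodule.coe_smul, map_smul, h1, coef_polyH]
  cases n with
  | zero => rw [coef_mulPoly_X_zero]; simp
  | succ n => rw [coef_mulPoly_X_succ, coef_adjoint_mulPoly_X]; simp [coeff_one]

/-- Let B be the backward shift. A Neumann series solves h - α B h = B g; applying the shift gives
(z - α) h = g up to a constant, so the range and the constants span `H²`. -/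
theorem cofg_range_X_sub_C_of_lt {α : ℂ} (hα : ‖α‖ < 1) : (mulPoly (X - C α)).range.CoFG := by
  refine cofg_iff_exists_fg.mpr ⟨ℂ ∙ oneH2, Submodule.fg_span_singleton _, ?_⟩
  refine eq_top_iff.mpr fun g _ => ?_
  have hB : ‖ContinuousLinearMap.adjoint (mulPoly X)‖ ≤ 1 := by
    rw [LinearIsometryEquiv.norm_map]
    exact norm_mulPoly_X_le
  obtain ⟨h, hh⟩ := exists_sub_smul_apply_eq hB hα (ContinuousLinearMap.adjoint (mulPoly X) g)
  have h2 := congrArg (mulPoly X) hh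
  rw [map_sub, map_smul, mulPoly_X_adjoint, mulPoly_X_adjoint] at h2
  refine Submodule.mem_sup.mpr ⟨mulPoly (X - C α) h, ⟨h, rfl⟩,
    (α * coef (0 : ℕ) (h : L2) + coef (0 : ℕ) (g : L2)) • oneH2,
    Submodule.smul_mem _ _ (Submodule.mem_span_singleton_self _), ?_⟩
  rw [mulPoly_X_sub_C, ← sub_eq_zero, ← sub_eq_zero.mpr h2]
  module

theorem range_X_sub_C_of_gt {α : ℂ} (hα : 1 < ‖α‖) : (mulPoly (X - C α)).range = ⊤ := by
  have hα0 : α ≠ 0 := norm_pos_iff.mp (zero_lt_one.trans hα)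
  have hα1 : ‖α⁻¹‖ < 1 := by
    rw [norm_inv]
    exact inv_lt_one_of_one_lt₀ hα
  refine eq_top_iff.mpr fun g _ => ?_
  obtain ⟨h, hh⟩ := exists_sub_smul_apply_eq norm_mulPoly_X_le hα1 (-α⁻¹ • g)
  refine ⟨h, (mulPoly_X_sub_C α h).trans ?_⟩
  have h2 : mulPoly X h - α • h = -α • (h - α⁻¹ • mulPoly X h) := by
    rw [smul_sub, smul_smul, neg_mul, mul_inv_cancel₀ hα0]
    module
  rw [h2, hh, smul_smul, neg_mul_neg, mul_inv_cancel₀ hα0, one_smul]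

/-- Each linear factor has range of finite codimension, whether its root is inside or outside the
circle, and this property survives composition. -/
theorem cofg_range_mulPoly {p : ℂ[X]} (hp : ∀ z, ‖z‖ = 1 → p.eval z ≠ 0) :
    (mulPoly p).range.CoFG := by
  have hp0 : p ≠ 0 := by
    rintro rfl
    exact hp 1 (by simp) (by simp)
  revert hp
  refine roots_induction (P := fun p => (∀ z, ‖z‖ = 1 → p.eval z ≠ 0) → (mulPoly p).range.CoFG)
    ?_ ?_ p hp0
  · intro a ha _
    have : (mulPoly (C a)).range = ⊤ := eq_top_iff.mpr fun x _ => ⟨a⁻¹ • x, by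
      change mulPoly (C a) (a⁻¹ • x) = x
      rw [mulPoly_C, smul_inv_smul₀ ha]⟩
    rw [this]
    exact Submodule.CoFG.top
  · intro α p _ ih hz
    have h1 := ih fun z hz1 h0 => hz z hz1 (by rw [eval_mul, h0, mul_zero])
    have hα : ‖α‖ ≠ 1 := fun h => hz α h (by simp)
    have h2 : (mulPoly (X - C α)).range.CoFG := by
      rcases hα.lt_or_gt with h | h
      · exact cofg_range_X_sub_C_of_lt h
      · rw [range_X_sub_C_of_gt h]
        exact Submodule.CoFG.top
    refine (cofg_map h2 h1).of_le ?_
    rintro _ ⟨_, ⟨x, rfl⟩, rfl⟩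
    exact ⟨x, mulPoly_mul _ _ _⟩

/-- Finite codimension would make the range closed. It is also dense, so it would contain 1,
contradicting `no_L2_inverse`. -/
theorem not_cofg_range_X_sub_C {α : ℂ} (hα : ‖α‖ = 1) : ¬ (mulPoly (X - C α)).range.CoFG := by
  intro h
  have h0 := X_sub_C_ne_zero α
  have hcl := isClosed_range_of_cofg _ (mulPoly_injective h0) h
  have hd := dense_range_mulPoly h0 fun z hz => by
    rw [eval_sub, eval_X, eval_C, sub_eq_zero] at hz
    rwa [hz]
  have h1 : oneH2 ∈ ((mulPoly (X - C α)).range : Set H2) := by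
    rw [← hcl.closure_eq, hd.closure_eq]
    trivial
  obtain ⟨u, hu⟩ := h1
  refine no_L2_inverse hα u ?_
  filter_upwards [coeFn_mulC (polyC (X - C α)) u, coeFn_fourierBasis 0] with t h1 h2
  have h3 : mulC (polyC (X - C α)) (u : L2) = (fourierBasis 0 : L2) := congrArg Subtype.val hu
  rw [h3, h2, fourier_zero, polyC_apply] at h1
  simpa using h1.symm

/-! ### Fredholm properties of operators with the graph of `T_{s/q}` -/

section Fredholm

variable {A : H2 →ₗ.[ℂ] H2} {s q : ℂ[X]}

theorem HasQuotGraph.isClosed (hA : HasQuotGraph A s q) : A.IsClosed := by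
  have : (A.graph : Set (H2 × H2)) =
      (fun x : H2 × H2 => mulPoly s x.1 - mulPoly q x.2) ⁻¹' (polyLT q.natDegree) :=
    Set.ext hA
  rw [LinearPMap.IsClosed, this]
  exact (polyLT q.natDegree).closed_of_finiteDimensional.preimage (by fun_prop)

/-- Solving s g - q k = p for q k: k is attained exactly when q k is in s H² up to a polynomial of
degree < deg q. Questions about the unbounded operator become questions about bounded
multiplications. -/
theorem HasQuotGraph.range_eq (hA : HasQuotGraph A s q) : LinearMap.range A.toFun =
    ((mulPoly s).range ⊔ polyLT q.natDegree).comap (mulPoly q : H2 →ₗ[ℂ] H2) := by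
  ext k
  rw [Submodule.mem_comap, Submodule.mem_sup]
  constructor
  · rintro ⟨x, rfl⟩
    have h := (hA ((x : H2), A x)).mp (LinearPMap.mem_graph A x)
    exact ⟨_, ⟨x, rfl⟩, _, neg_mem h, by simp⟩
  · rintro ⟨_, ⟨g, rfl⟩, p, hp, h⟩
    have h1 : (g, k) ∈ A.graph := by
      rw [hA]
      have h2 : mulPoly s g - mulPoly q k = -p := by
        rw [← ContinuousLinearMap.coe_coe (mulPoly q), ← h]
        simp
      simp only
      rw [h2]
      exact neg_mem hp
    obtain ⟨y, -, hy⟩ := (LinearPMap.mem_graph_iff _).mp h1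
    exact ⟨y, hy⟩

theorem HasQuotGraph.isFredholmOp (hA : HasQuotGraph A s q)
    (hs : ∀ z, ‖z‖ = 1 → s.eval z ≠ 0) : IsFredholmOp A := by
  have hs0 : s ≠ 0 := by
    rintro rfl
    exact hs 1 (by simp) (by simp)
  have hco := cofg_range_mulPoly hs
  have hcl := isClosed_range_of_cofg _ (mulPoly_injective hs0) hco
  refine ⟨hA.isClosed, ?_, ?_, ?_⟩
  · let φ : LinearMap.ker A.toFun →ₗ[ℂ] polyLT q.natDegree :=
      ((mulPoly s : H2 →ₗ[ℂ] H2) ∘ₗ A.domain.subtype ∘ₗ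
        (LinearMap.ker A.toFun).subtype).codRestrict _ fun x => by
          have h := (hA (((x : A.domain) : H2), A x)).mp (LinearPMap.mem_graph A x)
          have h0 : A x = 0 := x.2
          rw [h0, map_zero, sub_zero] at h
          exact h
    refine Module.Finite.of_injective φ fun x y hxy => ?_
    exact Subtype.ext (Subtype.ext (mulPoly_injective hs0 (congrArg Subtype.val hxy)))
  · rw [hA.range_eq]
    exact (Submodule.isClosed_sup_finiteDimensional _ _ hcl).preimage (mulPoly q).continuous
  · rw [hA.range_eq]
    exact cofg_comap _ (hco.of_le le_sup_left)

/-- A range of finite codimension would force the same for s H² ⊆ (z - α) H². Coprimality lets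
finite codimension pass from the preimage under multiplication by q to s H² plus polynomials. -/
theorem HasQuotGraph.not_isFredholmOp (hA : HasQuotGraph A s q) (hsq : IsCoprime s q) {α : ℂ}
    (hα : ‖α‖ = 1) (hs : s.eval α = 0) : ¬ IsFredholmOp A := by
  rintro ⟨-, -, -, h⟩
  rw [hA.range_eq] at h
  obtain ⟨a, b, hab⟩ := hsq
  have h1 : ((mulPoly s).range ⊔ polyLT q.natDegree).CoFG := by
    obtain ⟨K, hK, hKtop⟩ := cofg_iff_exists_fg.mp h
    refine cofg_iff_exists_fg.mpr ⟨K.map (mulPoly q : H2 →ₗ[ℂ] H2), hK.map _, ?_⟩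
    refine eq_top_iff.mpr fun x _ => ?_
    -- Bézout writes x = s (a x) + q (b x); only b x must be split along the range and its finite
    -- complement.
    obtain ⟨r, hr, k, hk, hrk⟩ := Submodule.mem_sup.mp (hKtop ▸ Submodule.mem_top : mulPoly b x ∈ _)
    have hx : x = (mulPoly s (mulPoly a x) + mulPoly q r) + mulPoly q k := by
      rw [add_assoc, ← map_add, hrk, ← mulPoly_mul, ← mulPoly_mul, ← mulPoly_add, mul_comm s,
        mul_comm q, hab, mulPoly_one]
    rw [hx]
    exact Submodule.add_mem_sup (add_mem (Submodule.mem_sup_left ⟨_, rfl⟩) hr) ⟨k, hk, rfl⟩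
  refine not_cofg_range_X_sub_C hα
    ((cofg_of_sup_fg (Module.Finite.iff_fg.mp inferInstance) h1).of_le ?_)
  obtain ⟨r, rfl⟩ := dvd_iff_isRoot.mpr hs
  rintro _ ⟨x, rfl⟩
  exact ⟨mulPoly r x, (mulPoly_mul _ _ _).symm⟩

theorem HasQuotGraph.subScalar (hA : HasQuotGraph A s q) (c : ℂ) :
    HasQuotGraph (subScalar A c) (s - C c * q) q := by
  rintro ⟨x, y⟩
  have h1 : (x, y) ∈ (ToeplitzLike.subScalar A c).graph ↔ (x, y + c • x) ∈ A.graph := by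
    rw [LinearPMap.mem_graph_iff, LinearPMap.mem_graph_iff]
    refine exists_congr fun z => and_congr_right fun hz => ?_
    change A z - c • (z : H2) = y ↔ A z = y + c • x
    rw [sub_eq_iff_eq_add, show (z : H2) = x from hz]
  rw [h1, hA]
  simp only
  rw [mulPoly_sub, mulPoly_C_mul, map_add, map_smul]
  congr! 1
  abel

/-- The operator shifted by c has symbol (s - c q)/q, and it fails to be Fredholm exactly when s - c
q has a zero on the circle. By coprimality such a zero is not a pole of ω, so it is a point where ω
= c. -/
theorem essSpectrum_toeplitz (hq : q ≠ 0) (hroots : ∀ z, q.eval z = 0 → ‖z‖ = 1)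
    (hsq : IsCoprime s q) :
    essSpectrum (toeplitz (algebraMap ℂ[X] (RatFunc ℂ) s / algebraMap ℂ[X] (RatFunc ℂ) q)) =
      circleImage (algebraMap ℂ[X] (RatFunc ℂ) s / algebraMap ℂ[X] (RatFunc ℂ) q) := by
  ext c
  have hA := (hasQuotGraph_toeplitz (s := s) hq hroots).subScalar c
  obtain ⟨a, b, hab⟩ := id hsq
  constructor
  · intro h
    by_contra hc
    refine h (hA.isFredholmOp fun z hz h0 => hc ⟨z, hz, ?_, ?_⟩)
    all_goals
      have hqz : q.eval z ≠ 0 := by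
        intro hqz
        have h1 := congrArg (Polynomial.eval z) hab
        rw [eval_sub, eval_mul, hqz, mul_zero, sub_zero] at h0
        simp [h0, hqz] at h1
    · rwa [isPole_div_iff hq hsq]
    · rw [eval_sub, eval_mul, eval_C, sub_eq_zero] at h0
      rw [val_div hqz, h0, mul_div_cancel_right₀ _ hqz]
  · rintro ⟨z, hz, hp, rfl⟩
    rw [isPole_div_iff hq hsq] at hp
    refine hA.not_isFredholmOp ⟨a, b + a * C _, by linear_combination hab⟩ hz ?_
    rw [eval_sub, eval_mul, eval_C, val_div hp, div_mul_cancel₀ _ hp, sub_self]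

end Fredholm

/-! ### Rational functions that are real on the circle -/

theorem exists_pt_eq {z : ℂ} (hz : ‖z‖ = 1) : ∃ t, pt t = z := by
  obtain ⟨t, ht⟩ := (AddCircle.homeomorphCircle one_ne_zero).surjective
    (⟨z, mem_sphere_zero_iff_norm.mpr hz⟩ : Circle)
  refine ⟨t, ?_⟩
  rw [AddCircle.homeomorphCircle_apply] at ht
  exact congrArg Subtype.val ht

theorem polyC_injective : Function.Injective polyC := fun p r h => by
  refine polyH_injective (Subtype.ext ?_)
  rw [polyH_apply, polyH_apply, coe_mulPoly, coe_mulPoly, h]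

theorem eq_of_eval_eq_on_circle {p r : ℂ[X]} (h : ∀ z, ‖z‖ = 1 → p.eval z = r.eval z) : p = r :=
  polyC_injective (by
    ext t
    rw [polyC_apply, polyC_apply]
    exact h _ (norm_pt t))

theorem realOnCircle_iff {s q : ℂ[X]} : RealOnCircle s q ↔
    ∀ z, ‖z‖ = 1 → s.eval z * conj (q.eval z) = conj (s.eval z) * q.eval z := by
  constructor
  · intro h z hz
    obtain ⟨t, rfl⟩ := exists_pt_eq hz
    have := congrArg (fun w : C(UnitAddCircle, ℂ) => w t) h
    simpa [polyC_apply] using this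
  · intro h
    unfold RealOnCircle
    ext t
    simpa [polyC_apply] using h _ (norm_pt t)

/-- The cross-multiplied identity is between continuous functions, so null sets, in particular
poles, do not matter. -/
theorem realOnCircle_of_ae {s q : ℂ[X]} (h : ∀ᵐ t ∂𝔪,
    ∃ x : ℝ, s.eval (pt t) / q.eval (pt t) = x) (hq : q ≠ 0) : RealOnCircle s q := by
  refine eq_of_ae_eq ?_
  filter_upwards [h, ae_eval_ne_zero hq] with t ⟨x, hx⟩ h2
  rw [div_eq_iff h2] at hx
  simp only [ContinuousMap.mul_apply, ContinuousMap.star_apply, polyC_apply, RCLike.star_def, hx,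
    map_mul, Complex.conj_ofReal]
  ring

theorem circleImage_subset_iff {s q : ℂ[X]} (hq : q ≠ 0) (hsq : IsCoprime s q) :
    circleImage (algebraMap ℂ[X] (RatFunc ℂ) s / algebraMap ℂ[X] (RatFunc ℂ) q) ⊆
      Set.range ((↑) : ℝ → ℂ) ↔ RealOnCircle s q := by
  constructor
  · intro h
    refine realOnCircle_of_ae ?_ hq
    filter_upwards [ae_eval_ne_zero hq] with t ht
    obtain ⟨x, hx⟩ := h ⟨pt t, norm_pt t, by rwa [isPole_div_iff hq hsq], rfl⟩
    rw [val_div ht] at hx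
    exact ⟨x, hx.symm⟩
  · rintro h _ ⟨z, hz, hp, rfl⟩
    rw [isPole_div_iff hq hsq] at hp
    have h1 := realOnCircle_iff.mp h z hz
    have hp' : conj (q.eval z) ≠ 0 := (_root_.map_ne_zero _).mpr hp
    have h2 : conj (s.eval z / q.eval z) = s.eval z / q.eval z := by
      rw [map_div₀, div_eq_div_iff hp' hp, h1]
    obtain ⟨x, hx⟩ := Complex.conj_eq_iff_real.mp h2
    exact ⟨x, by rw [val_div hp, hx]⟩

/-! ### Self-inversive polynomials -/

theorem eval_sharp (p : ℂ[X]) {z : ℂ} (hz : ‖z‖ = 1) :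
    (sharp p).eval z = z ^ p.natDegree * conj (p.eval z) := by
  have h1 := mul_conj_of_norm_eq_one hz
  let i : Invertible (conj z) := ⟨z, h1, by rw [mul_comm, h1]⟩
  have h2 := eval₂_reverse_mul_pow (RingHom.id ℂ) (conj z) (p.map (starRingEnd ℂ))
  have h3 : eval (conj z) (p.map (starRingEnd ℂ)) = conj (p.eval z) := by
    rw [eval_map, eval₂_at_apply]
  have h4 : (⅟(conj z) : ℂ) = z := rfl
  rw [eval₂_id, eval₂_id, natDegree_map, h3, h4] at h2
  rw [← h2, sharp]
  calc _ = eval z (p.map (starRingEnd ℂ)).reverse * (z * conj z) ^ p.natDegree := by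
        rw [h1, one_pow, mul_one]
    _ = _ := by ring

theorem coeff_zero_sharp (p : ℂ[X]) : (sharp p).coeff 0 = conj p.leadingCoeff := by
  rw [sharp, coeff_zero_reverse, leadingCoeff_map]

theorem sharp_X_pow_mul (k : ℕ) (p : ℂ[X]) : sharp (X ^ k * p) = sharp p := by
  rw [sharp, Polynomial.map_mul, Polynomial.map_pow, map_X, reverse_X_pow_mul, sharp]

/-- Realness on the circle of `s / q`, as an identity of polynomials. -/
theorem realOnCircle_iff_sharp {s q : ℂ[X]} (hq : q ≠ 0) {c : ℂ} (hc : sharp q = C c * q) :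
    RealOnCircle s q ↔ C c * X ^ s.natDegree * s = X ^ q.natDegree * sharp s := by
  have hcz : ∀ z : ℂ, ‖z‖ = 1 → z ^ q.natDegree * conj (q.eval z) = c * q.eval z := fun z hz => by
    rw [← eval_sharp q hz, hc, eval_mul, eval_C]
  rw [realOnCircle_iff]
  constructor
  · intro h
    refine mul_right_cancel₀ hq (eq_of_eval_eq_on_circle fun z hz => ?_)
    simp only [eval_mul, eval_C, eval_pow, eval_X, eval_sharp s hz]
    linear_combination z ^ s.natDegree * z ^ q.natDegree * h z hz -
      z ^ s.natDegree * s.eval z * hcz z hz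
  · intro h z hz
    have h1 := congrArg (Polynomial.eval z) h
    simp only [eval_mul, eval_C, eval_pow, eval_X, eval_sharp s hz] at h1
    have hz0 : z ≠ 0 := norm_ne_zero_iff.mp (by rw [hz]; exact one_ne_zero)
    refine mul_left_cancel₀ (pow_ne_zero (s.natDegree + q.natDegree) hz0) ?_
    rw [pow_add]
    linear_combination z ^ s.natDegree * s.eval z * hcz z hz + q.eval z * h1

theorem exists_sharp_eq {q : ℂ[X]} (hq : q ≠ 0) (hroots : ∀ z, q.eval z = 0 → ‖z‖ = 1) :
    ∃ c : ℂ, c ≠ 0 ∧ sharp q = C c * q := by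
  obtain ⟨c, hc, h⟩ := exists_conj_eval hq hroots
  exact ⟨c, hc, eq_of_eval_eq_on_circle fun z hz => by
    rw [eval_sharp q hz, h z hz, eval_mul, eval_C]⟩

theorem realOnCircle_iff_selfInversive {s q : ℂ[X]} (hq : q ≠ 0)
    (hroots : ∀ z, q.eval z = 0 → ‖z‖ = 1) :
    RealOnCircle s q ↔ s = 0 ∨ (s.natDegree ≤ q.natDegree ∧
      (∃ r : ℂ[X], SelfInversive r ∧ s = X ^ (q.natDegree - s.natDegree) * r) ∧
      q.coeff 0 * conj (s.coeff s.natDegree) =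
        conj (q.coeff q.natDegree) * s.coeff (q.natDegree - s.natDegree)) := by
  obtain ⟨c, hc0, hc⟩ := exists_sharp_eq hq hroots
  have hc1 : conj (q.coeff q.natDegree) = c * q.coeff 0 := by
    rw [← coeff_C_mul, ← hc, coeff_zero_sharp, leadingCoeff]
  have hX : (X : ℂ[X]) ≠ 0 := X_ne_zero
  rw [realOnCircle_iff_sharp hq hc]
  rcases eq_or_ne s 0 with rfl | hs
  · simp [sharp]
  have hlead : conj s.leadingCoeff ≠ 0 := (_root_.map_ne_zero _).mpr (leadingCoeff_ne_zero.mpr hs)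
  rw [or_iff_right hs]
  constructor
  · intro h
    have hnm : s.natDegree ≤ q.natDegree := by
      by_contra! hlt
      obtain ⟨k, hk⟩ := Nat.exists_eq_add_of_lt hlt
      -- If deg s > deg q, a power of z remains on the left, while s♯ has the nonzero constant term
      -- conj(s_n), where n = deg s.
      have h1 : C c * X ^ (k + 1) * s = sharp s := by
        refine mul_left_cancel₀ (pow_ne_zero q.natDegree hX) ?_
        rw [← h, hk]
        ring
      have h2 := congrArg (fun p => p.coeff 0) h1
      simp only [coeff_zero_sharp, mul_coeff_zero, coeff_X_pow] at h2
      simp at h2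
      exact hlead h2.symm
    obtain ⟨k, hk⟩ := Nat.exists_eq_add_of_le hnm
    have hk' : q.natDegree - s.natDegree = k := by omega
    rw [hk']
    have h1 : C c * s = X ^ k * sharp s := by
      refine mul_left_cancel₀ (pow_ne_zero s.natDegree hX) ?_
      linear_combination h + (congrArg (fun i => X ^ i * sharp s) hk)
    have h2 : s = X ^ k * (C c⁻¹ * sharp s) := by
      rw [mul_left_comm, ← h1, ← mul_assoc, ← C_mul, inv_mul_cancel₀ hc0, C_1, one_mul]
    refine ⟨hnm, ⟨C c⁻¹ * sharp s, ⟨?_, c⁻¹, ?_⟩, h2⟩, ?_⟩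
    · intro h0
      rw [h0, mul_zero] at h2
      exact hs h2
    -- Since ♯ ignores factors of z, the quotient r = c⁻¹ s♯ has r♯ = s♯, which makes it
    -- self-inversive with constant c⁻¹.
    · rw [← sharp_X_pow_mul k (C c⁻¹ * sharp s), ← h2]
    · have h3 := congrArg (fun p => p.coeff k) h1
      simp only [coeff_C_mul, coeff_X_pow_mul', le_refl, if_true, Nat.sub_self,
        coeff_zero_sharp] at h3
      rw [hc1, coeff_natDegree, ← h3]
      ring
  · rintro ⟨hnm, ⟨r, ⟨-, γ, hγ⟩, hr⟩, hcoef⟩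
    have hq0 : q.coeff 0 ≠ 0 := fun h0 => by
      have := hroots 0 (by rwa [← coeff_zero_eq_eval_zero])
      simp at this
    have hsr : sharp s = sharp r := by
      conv_lhs => rw [hr]
      exact sharp_X_pow_mul _ _
    rw [← hsr] at hγ
    have h1 : s.coeff (q.natDegree - s.natDegree) = γ * conj s.leadingCoeff := by
      have h2 := congrArg (fun p => p.coeff (q.natDegree - s.natDegree)) hr
      simp only [coeff_X_pow_mul', le_refl, if_true, Nat.sub_self] at h2
      rw [h2, hγ, coeff_C_mul, coeff_zero_sharp]
    rw [h1, hc1, coeff_natDegree] at hcoef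
    -- The coefficient condition serves exactly to tie the constant of r to that of q; q_0 ≠ 0
    -- because 0 is not on the circle.
    have hcγ : c * γ = 1 := by
      refine mul_left_cancel₀ (mul_ne_zero hq0 hlead) ?_
      linear_combination -hcoef
    calc C c * X ^ s.natDegree * s
        = X ^ s.natDegree * X ^ (q.natDegree - s.natDegree) * (C c * r) := by
          linear_combination C c * X ^ s.natDegree * hr
      _ = X ^ q.natDegree * sharp s := by
          rw [← pow_add, Nat.add_sub_cancel' hnm, hγ, ← mul_assoc (C c), ← C_mul, hcγ, C_1, one_mul]

/-! ### The Cayley transform -/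

/-- The polynomial `(w + i) ^ N * p ((w - i) / (w + i))`. -/
def cayleyPoly (N : ℕ) (p : ℂ[X]) : ℂ[X] :=
  ∑ k ∈ Finset.range (N + 1), C (p.coeff k) * (X - C Complex.I) ^ k * (X + C Complex.I) ^ (N - k)

theorem eval_cayleyPoly {N : ℕ} {p : ℂ[X]} (hp : p.natDegree ≤ N) {w : ℂ} (hw : w + Complex.I ≠ 0) :
    (cayleyPoly N p).eval w =
      (w + Complex.I) ^ N * p.eval ((w - Complex.I) / (w + Complex.I)) := by
  rw [eval_eq_sum_range' (Nat.lt_succ_of_le hp), cayleyPoly, eval_finsetSum, Finset.mul_sum]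
  refine Finset.sum_congr rfl fun k hk => ?_
  have hk' : k ≤ N := Nat.lt_succ_iff.mp (Finset.mem_range.mp hk)
  simp only [eval_mul, eval_C, eval_pow, eval_sub, eval_add, eval_X, div_pow]
  rw [← pow_sub_mul_pow (w + Complex.I) hk']
  field_simp

/-- The point -i is where the Cayley transform is infinite; only the top term survives, so -i is no
root when N = deg p and p ≠ 0. -/
theorem eval_cayleyPoly_neg_I (N : ℕ) (p : ℂ[X]) :
    (cayleyPoly N p).eval (-Complex.I) = p.coeff N * (-2 * Complex.I) ^ N := by
  rw [cayleyPoly, eval_finsetSum, Finset.sum_range_succ, Finset.sum_eq_zero, zero_add]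
  · simp only [eval_mul, eval_C, eval_pow, eval_sub, eval_X, Nat.sub_self, pow_zero, mul_one]
    congr 2
    ring
  · intro k hk
    have : N - k ≠ 0 := by
      have := Finset.mem_range.mp hk
      omega
    simp [this]

theorem invCayley_add_I {z : ℂ} (hz : z ≠ 1) : invCayley z + Complex.I ≠ 0 := by
  have h1 : z - 1 ≠ 0 := sub_ne_zero.mpr hz
  have h2 : invCayley z + Complex.I = -2 * Complex.I / (z - 1) := by
    unfold invCayley
    field_simp
    ring
  rw [h2]
  exact div_ne_zero (mul_ne_zero (by norm_num) Complex.I_ne_zero) h1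

theorem cayley_invCayley {z : ℂ} (hz : z ≠ 1) :
    (invCayley z - Complex.I) / (invCayley z + Complex.I) = z := by
  rw [div_eq_iff (invCayley_add_I hz)]
  have h1 : z - 1 ≠ 0 := sub_ne_zero.mpr hz
  unfold invCayley
  field_simp
  ring

theorem conj_invCayley {z : ℂ} (hz : ‖z‖ = 1) (hz1 : z ≠ 1) :
    conj (invCayley z) = invCayley z := by
  have h1 := mul_conj_of_norm_eq_one hz
  have h2 : z - 1 ≠ 0 := sub_ne_zero.mpr hz1
  have h3 : conj z - 1 ≠ 0 := fun h => h2 (by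
    rw [sub_eq_zero] at h ⊢
    rw [h, mul_one] at h1
    exact h1)
  unfold invCayley
  simp only [map_mul, map_neg, map_div₀, map_add, map_sub, map_one, Complex.conj_I]
  rw [neg_neg, neg_mul, ← mul_neg, ← neg_div]
  congr 1
  rw [div_eq_div_iff h3 h2]
  linear_combination 2 * h1

theorem im_eq_zero_of_norm_cayley {w : ℂ} (hw : w + Complex.I ≠ 0)
    (h : ‖(w - Complex.I) / (w + Complex.I)‖ = 1) : w.im = 0 := by
  rw [norm_div, div_eq_one_iff_eq (norm_ne_zero_iff.mpr hw)] at h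
  have h1 := congrArg (fun x => x ^ 2) h
  simp only [← Complex.normSq_eq_norm_sq, Complex.normSq_apply, Complex.sub_re, Complex.sub_im,
    Complex.add_re, Complex.add_im, Complex.I_re, Complex.I_im] at h1
  linarith

theorem ofReal_add_I_ne_zero (x : ℝ) : (x : ℂ) + Complex.I ≠ 0 := fun h => by
  have := congrArg Complex.im h
  simp at this

theorem norm_cayley_ofReal (x : ℝ) : ‖((x : ℂ) - Complex.I) / (x + Complex.I)‖ = 1 := by
  have h : (x : ℂ) - Complex.I = conj ((x : ℂ) + Complex.I) := by simp [sub_eq_add_neg]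
  rw [norm_div, h, Complex.norm_conj, div_self (norm_ne_zero_iff.mpr (ofReal_add_I_ne_zero x))]

/-- A complex polynomial that is real on the real line has real coefficients. -/
theorem exists_real_polynomial {P : ℂ[X]} (h : ∀ x : ℝ, conj (P.eval (x : ℂ)) = P.eval (x : ℂ)) :
    ∃ A : ℝ[X], A.map (algebraMap ℝ ℂ) = P := by
  have h1 : P.map (starRingEnd ℂ) = P := by
    refine eq_of_infinite_eval_eq _ _ ((Set.infinite_range_of_injective
      Complex.ofReal_injective).mono ?_)
    rintro _ ⟨x, rfl⟩
    have h2 : eval (conj (x : ℂ)) (P.map (starRingEnd ℂ)) = conj (P.eval (x : ℂ)) := by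
      rw [eval_map, eval₂_at_apply]
    rw [Complex.conj_ofReal, h] at h2
    exact h2
  refine (mem_lifts P).mp ((lifts_iff_coeff_lifts P).mpr fun n => ?_)
  have h2 := congrArg (fun p => p.coeff n) h1
  simp only [coeff_map] at h2
  obtain ⟨x, hx⟩ := Complex.conj_eq_iff_real.mp h2
  exact ⟨x, hx.symm⟩

theorem eval_map_conj (P : ℂ[X]) (w : ℂ) :
    (P.map (starRingEnd ℂ)).eval w = conj (P.eval (conj w)) := by
  have h := eval₂_at_apply (p := P) (starRingEnd ℂ) (conj w)
  rwa [Complex.conj_conj, ← eval_map] at h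

theorem ratFunc_eval_div {A B : ℝ[X]} {w : ℂ} (hw : B.aeval w ≠ 0) :
    (algebraMap ℝ[X] (RatFunc ℝ) A / algebraMap ℝ[X] (RatFunc ℝ) B).eval (algebraMap ℝ ℂ) w =
      A.aeval w / B.aeval w := by
  have hB : B ≠ 0 := by
    rintro rfl
    simp at hw
  set τ := algebraMap ℝ[X] (RatFunc ℝ) A / algebraMap ℝ[X] (RatFunc ℝ) B with hτ
  have h := (RatFunc.num_mul_eq_mul_denom_iff (x := τ) (p := A) hB).mpr rfl
  obtain ⟨d, hd⟩ := RatFunc.denom_div_dvd A B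
  have h2 : τ.denom.aeval w ≠ 0 := fun h0 => hw (by rw [hd, map_mul, h0, zero_mul])
  have h3 := congrArg (aeval w) h
  rw [map_mul, map_mul] at h3
  rw [RatFunc.eval, ← aeval_def, ← aeval_def, div_eq_div_iff h2 hw, h3]

/-- Substituting the Cayley transform gives S/Q, real on the line but with possibly complex
coefficients. Expanding it by the coefficientwise conjugate of Q makes numerator and denominator
real there, hence real polynomials, and adds only roots that are conjugates of real ones. -/
theorem exists_real_ratFunc {s q : ℂ[X]} (hq : q ≠ 0) (hroots : ∀ z, q.eval z = 0 → ‖z‖ = 1)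
    (hsq : IsCoprime s q) (hdeg : s.natDegree ≤ q.natDegree) (h : RealOnCircle s q) :
    ∃ τ : RatFunc ℝ, PolesOnReal τ ∧
      EqCompInvCayley (algebraMap ℂ[X] (RatFunc ℂ) s / algebraMap ℂ[X] (RatFunc ℂ) q) τ := by
  set m := q.natDegree with hm
  set S := cayleyPoly m s with hS
  set Q := cayleyPoly m q with hQ
  have hQroot : ∀ w, Q.eval w = 0 → w.im = 0 := by
    intro w hw
    by_cases hwI : w + Complex.I = 0
    · rw [eq_neg_of_add_eq_zero_left hwI, hQ, eval_cayleyPoly_neg_I, hm, coeff_natDegree] at hw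
      exact absurd hw (mul_ne_zero (leadingCoeff_ne_zero.mpr hq)
        (pow_ne_zero _ (mul_ne_zero (by norm_num) Complex.I_ne_zero)))
    · rw [hQ, eval_cayleyPoly le_rfl hwI] at hw
      exact im_eq_zero_of_norm_cayley hwI
        (hroots _ ((mul_eq_zero.mp hw).resolve_left (pow_ne_zero _ hwI)))
  have hQroot' : ∀ w, (Q.map (starRingEnd ℂ)).eval w = 0 → w.im = 0 := by
    intro w hw
    rw [eval_map_conj, map_eq_zero] at hw
    simpa using hQroot _ hw
  have hreal : ∀ x : ℝ, conj ((S * Q.map (starRingEnd ℂ)).eval (x : ℂ)) =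
      (S * Q.map (starRingEnd ℂ)).eval (x : ℂ) := by
    intro x
    -- At real x the product is |x + i|^(2m) s(z) conj(q(z)) with z on the circle.
    have h1 := realOnCircle_iff.mp h _ (norm_cayley_ofReal x)
    rw [eval_mul, eval_map_conj, Complex.conj_ofReal, hS, hQ,
      eval_cayleyPoly hdeg (ofReal_add_I_ne_zero x),
      eval_cayleyPoly le_rfl (ofReal_add_I_ne_zero x)]
    simp only [map_mul, Complex.conj_conj]
    linear_combination -(conj (((x : ℂ) + Complex.I) ^ m)) * ((x : ℂ) + Complex.I) ^ m * h1
  obtain ⟨A, hA⟩ := exists_real_polynomial hreal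
  obtain ⟨B, hB⟩ := exists_real_polynomial (P := Q * Q.map (starRingEnd ℂ)) fun x => by
    rw [eval_mul, eval_map_conj, Complex.conj_ofReal, map_mul, Complex.conj_conj, mul_comm]
  have hAw : ∀ w, A.aeval w = S.eval w * (Q.map (starRingEnd ℂ)).eval w := fun w => by
    rw [← eval_mul, ← hA, eval_map_algebraMap]
  have hBw : ∀ w, B.aeval w = Q.eval w * (Q.map (starRingEnd ℂ)).eval w := fun w => by
    rw [← eval_mul, ← hB, eval_map_algebraMap]
  refine ⟨algebraMap ℝ[X] (RatFunc ℝ) A / algebraMap ℝ[X] (RatFunc ℝ) B, fun w hw => ?_,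
    fun z hz1 hz _ => ?_⟩
  · obtain ⟨d, hd⟩ := RatFunc.denom_div_dvd A B
    have h1 : B.aeval w = 0 := by rw [hd, map_mul, hw, zero_mul]
    rw [hBw] at h1
    exact (mul_eq_zero.mp h1).elim (hQroot w) (hQroot' w)
  · rw [isPole_div_iff hq hsq] at hz
    have hwI := invCayley_add_I hz1
    have hQw : Q.eval (invCayley z) = (invCayley z + Complex.I) ^ m * q.eval z := by
      rw [hQ, eval_cayleyPoly le_rfl hwI, cayley_invCayley hz1]
    have hSw : S.eval (invCayley z) = (invCayley z + Complex.I) ^ m * s.eval z := by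
      rw [hS, eval_cayleyPoly hdeg hwI, cayley_invCayley hz1]
    have hQ0 : Q.eval (invCayley z) ≠ 0 := by
      rw [hQw]
      exact mul_ne_zero (pow_ne_zero _ hwI) hz
    have hQ1 : (Q.map (starRingEnd ℂ)).eval (invCayley z) ≠ 0 := by
      intro h0
      have h1 : conj (invCayley z) = invCayley z := Complex.conj_eq_iff_im.mpr (hQroot' _ h0)
      rw [eval_map_conj, map_eq_zero, h1] at h0
      exact hQ0 h0
    rw [ratFunc_eval_div (by rw [hBw]; exact mul_ne_zero hQ0 hQ1), hAw, hBw,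
      mul_div_mul_right _ _ hQ1, hSw, hQw, mul_div_mul_left _ _ (pow_ne_zero _ hwI), val_div hz]

theorem ae_pt_notMem (F : Finset ℂ) : ∀ᵐ t ∂𝔪, pt t ∉ F := by
  filter_upwards [ae_eval_ne_zero (q := ∏ ζ ∈ F, (X - C ζ))
    (Finset.prod_ne_zero_iff.mpr fun ζ _ => X_sub_C_ne_zero ζ)] with t ht hF
  refine ht ?_
  rw [eval_prod]
  exact Finset.prod_eq_zero hF (by simp)

/-- The inverse Cayley transform maps the circle minus 1 to the real line, where τ takes real
values; the finitely many excluded points form a null set. -/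
theorem realOnCircle_of_eqCompInvCayley {s q : ℂ[X]} (hq : q ≠ 0) (hsq : IsCoprime s q)
    {τ : RatFunc ℝ}
    (h : EqCompInvCayley (algebraMap ℂ[X] (RatFunc ℂ) s / algebraMap ℂ[X] (RatFunc ℂ) q) τ) :
    RealOnCircle s q := by
  classical
  refine realOnCircle_of_ae ?_ hq
  set D := τ.denom.map (algebraMap ℝ ℂ) with hD
  have hD0 : D ≠ 0 := (Polynomial.map_ne_zero_iff (algebraMap ℝ ℂ).injective).mpr τ.denom_ne_zero
  filter_upwards [ae_eval_ne_zero hq, ae_pt_notMem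
    (insert 1 (D.roots.toFinset.image fun w => (w - Complex.I) / (w + Complex.I)))] with t h1 h2
  simp only [Finset.mem_insert, Finset.mem_image, Multiset.mem_toFinset, not_or, not_exists,
    not_and] at h2
  obtain ⟨hne, hroot⟩ := h2
  have h3 : τ.denom.aeval (invCayley (pt t)) ≠ 0 := fun h0 =>
    hroot (invCayley (pt t)) (by
      rw [mem_roots hD0, IsRoot, hD, eval_map_algebraMap, h0]) (cayley_invCayley hne)
  have h4 := h (pt t) hne (by rwa [isPole_div_iff hq hsq]) h3
  obtain ⟨x, hx⟩ := Complex.conj_eq_iff_real.mp (conj_invCayley (norm_pt t) hne)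
  rw [val_div h1, hx, RatFunc.eval] at h4
  refine ⟨τ.num.eval x / τ.denom.eval x, h4.trans ?_⟩
  have h5 : ∀ p : ℝ[X], eval₂ (algebraMap ℝ ℂ) (x : ℂ) p = (p.eval x : ℝ) := fun p =>
    eval₂_at_apply (algebraMap ℝ ℂ) x
  rw [h5, h5, Complex.ofReal_div]

end ToeplitzLike
end

/-! ### The equivalences -/

theorem theorem5p1 (ω : RatFunc ℂ) (hω : ω ∈ RatT) (s q : ℂ[X]) (hq : q ≠ 0)
    (hsq : IsCoprime s q)
    (hωsq : ω = algebraMap ℂ[X] (RatFunc ℂ) s / algebraMap ℂ[X] (RatFunc ℂ) q) :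
    [ IsSymmetricOp (toeplitz ω).adjoint,
      circleImage ω ⊆ Set.range ((↑) : ℝ → ℂ),
      ∃ τ : RatFunc ℝ, PolesOnReal τ ∧ EqCompInvCayley ω τ,
      essSpectrum (toeplitz ω) ⊆ Set.range ((↑) : ℝ → ℂ),
      s = 0 ∨ (s.natDegree ≤ q.natDegree ∧
        (∃ r : ℂ[X], SelfInversive r ∧ s = X ^ (q.natDegree - s.natDegree) * r) ∧
        q.coeff 0 * conj (s.coeff s.natDegree) =
          conj (q.coeff q.natDegree) * s.coeff (q.natDegree - s.natDegree)) ].TFAE ∧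
    (IsSymmetricOp (toeplitz ω).adjoint → (toeplitz ω).adjoint ≤ toeplitz ω) := by
  subst hωsq
  have hroots : ∀ z, q.eval z = 0 → ‖z‖ = 1 := fun z hz =>
    hω z ((isPole_div_iff hq hsq z).mpr hz)
  have hA := hasQuotGraph_toeplitz (s := s) hq hroots
  refine ⟨?_, fun h => hA.adjoint_le hq hroots (hA.realOnCircle hq hroots h)⟩
  -- Conditions 2, 4 and 5 all become `RealOnCircle s q`, which serves as the hub.
  rw [← realOnCircle_iff_selfInversive hq hroots, essSpectrum_toeplitz hq hroots hsq,
    circleImage_subset_iff hq hsq]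
  tfae_have 1 → 2 := hA.realOnCircle hq hroots
  tfae_have 2 → 1 := hA.isSymmetricOp hq hroots
  tfae_have 3 → 2 := fun ⟨_, _, h⟩ => realOnCircle_of_eqCompInvCayley hq hsq h
  tfae_have 2 → 3 := fun h => by
    -- Condition 5 supplies deg s ≤ deg q, needed to homogenize both polynomials with the same power
    -- of w + i.
    refine exists_real_ratFunc hq hroots hsq ?_ h
    rcases (realOnCircle_iff_selfInversive hq hroots).mp h with rfl | h1
    · simp
    · exact h1.1
  tfae_have 2 ↔ 4 := Iff.rfl
  tfae_have 2 ↔ 5 := Iff.rfl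
  tfae_finish
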